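/- Let $d\ge 1$ and let $(X_t)_{t\ge 0}$ be a (jointly measurable, temporally homogeneous) Markov process on $\mathbb R^d$ with transition semigroup $P_tf(x)=\mathbb E^x[f(X_t)]$ and invariant probability measure $\mu$. Let $\mathcal L$, with domain $\mathscr D(\mathcal L)$, be the infinitesimal generator of $(P_t)_{t\ge0}$ on $L^2(\mu)$, and assume $L^2(\mu)$-coercivity: there is a constant $\lambda>0$ such that $$\langle -\mathcal L f,f\rangle_{L^2(\mu)}\ \ge\ \lambda\,\|f\|_{L^2(\mu)}^2\qquad\text{for all } f\in\mathscr D(\mathcal L)\text{ with } \mu(f)=0 .$$ (This forces the process to be ergodic with respect to $\mu$.) Let $p>0$ and assume that $\int_{\mathbb R^d}|x|^q\,\mu(\mathrm dx)<\infty$ for some $q>p$. For $T>0$ let $\mu_T:=\frac1T\int_0^T\delta_{X_t}\,\mathrm dt$ be the empirical measure, and for probability measures $\nu_0,\nu_1$ on $\mathbb R^d$ let $$\mathcal T_p(\nu_0,\nu_1):=\inf_{\pi}\int_{\mathbb R^d\times\mathbb R^d}|x-y|^p\,\pi(\mathrm dx,\mathrm dy),$$ the infimum being over all couplings $\pi$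 of $\nu_0$ and $\nu_1$. Let $\mathbb E^\mu$ denote the expectation when $X_0$ has law $\mu$. Put $\gamma_2:=\max\{\tfrac12,\,1-\tfrac pd\}$. Then there exists a constant $C>0$ such that for all $T\ge 2$, $$\mathbb E^\mu\big[\mathcal T_p(\mu_T,\mu)\big]\ \le\ C\,T^{-\left(1-\max\{\gamma_2,\,p/q\}\right)}\Big(\mathbf 1_{\{\gamma_2q=p\}}\log T+\mathbf 1_{\{\gamma_2q\ne p\}}\Big)\Big(\mathbf 1_{\{p=d/2\}}\log T+\mathbf 1_{\{p\ne d/2\}}\Big).$$ In particular, if $q>2p$, then for all $T\ge2$, $$\mathbb E^\mu\big[\mathcal T_p(\mu_T,\mu)\big]\ \le\ \begin{cases} C\,T^{-1/2} & \text{if } p>\tfrac d2,\\ C\,T^{-1/2}\log T & \text{if } p=\tfrac d2,\\ C\,T^{-p/d} & \text{if } p<\tfrac d2.\end{cases}$$ -/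

import Mathlib

open MeasureTheory ProbabilityTheory Filter Topology
open scoped NNReal ENNReal

/-- A temporally homogeneous Markov process `(Ω, (X_t)_{t ≥ 0}, (ℙ^x)_{x ∈ E})` with state space `E`:
a jointly measurable process `X` and a measurable family of laws `ℙ^x = law x` such that
`ℙ^x (X_0 = x) = 1` and, with respect to its own past,
`ℙ^x (X_{t+s} ∈ A | σ(X_r : r ≤ t)) = ℙ^{X_t} (X_s ∈ A)` almost surely under `ℙ^x`. -/
structure MarkovFamily (E Ω : Type*) [MeasurableSpace E] [MeasurableSpace Ω] where
  /-- the process -/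
  X : ℝ≥0 → Ω → E
  /-- the law `ℙ^x` of the process started at `x` -/
  law : Kernel E Ω
  isMarkovKernel_law : IsMarkovKernel law
  measurable_X : Measurable (fun z : ℝ≥0 × Ω => X z.1 z.2)
  start : ∀ x, ∀ᵐ ω ∂(law x), X 0 ω = x
  markov : ∀ (x : E) (s t : ℝ≥0) (A : Set E), MeasurableSet A →
    (law x)[(X (t + s) ⁻¹' A).indicator (fun _ => (1 : ℝ)) |
        ⨆ (r : ℝ≥0) (_ : r ≤ t), MeasurableSpace.comap (X r) inferInstance]
      =ᵐ[law x] fun ω => (law (X t ω)).real (X s ⁻¹' A)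

namespace MarkovFamily

variable {E Ω : Type*} [MeasurableSpace E] [MeasurableSpace Ω]

/-- The law `ℙ^ν = ∫ ℙ^x ν(dx)` of the process with initial distribution `ν`. -/
noncomputable def lawFrom (P : MarkovFamily E Ω) (ν : Measure E) : Measure Ω :=
  ν.bind P.law

/-- The transition semigroup `P_t f (x) = 𝔼^x [f (X_t)]`. -/
noncomputable def semigroup (P : MarkovFamily E Ω) (t : ℝ≥0) (f : E → ℝ) (x : E) : ℝ :=
  ∫ ω, f (P.X t ω) ∂(P.law x)

/-- `μ` is invariant: `μ P_t = μ` for all `t ≥ 0`, where `P_t(x, ·)` is the law of `X_t`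
under `ℙ^x`. -/
def IsInvariant (P : MarkovFamily E Ω) (μ : Measure E) : Prop :=
  ∀ t : ℝ≥0, Kernel.Invariant (P.law.map (P.X t)) μ

/-- `f ∈ 𝒟(ℒ)` and `ℒ f = g`, where `ℒ` is the infinitesimal generator of `(P_t)` on `L²(μ)`:
`f, g ∈ L²(μ)` and `(P_t f - f) / t → g` in `L²(μ)` as `t ↓ 0`. -/
def HasGenerator (P : MarkovFamily E Ω) (μ : Measure E) (f g : E → ℝ) : Prop :=
  MemLp f 2 μ ∧ MemLp g 2 μ ∧
    Tendsto (fun t : ℝ≥0 => eLpNorm (fun x => (P.semigroup t f x - f x) / (t : ℝ) - g x) 2 μ)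
      (𝓝[>] 0) (𝓝 0)

/-- `L²(μ)`-coercivity: for some `lam > 0`, `⟨-ℒ f, f⟩_{L²(μ)} ≥ lam ‖f‖²_{L²(μ)}`
for all `f ∈ 𝒟(ℒ)` with `μ(f) = 0`. -/
def IsCoercive (P : MarkovFamily E Ω) (μ : Measure E) : Prop :=
  ∃ lam : ℝ, 0 < lam ∧ ∀ f g : E → ℝ, P.HasGenerator μ f g → ∫ x, f x ∂μ = 0 →
    lam * ∫ x, f x ^ 2 ∂μ ≤ ∫ x, (-g x) * f x ∂μ

/-- The empirical measure `μ_T = (1/T) ∫_0^T δ_{X_t} dt`, that is, the image of the uniform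
distribution on `(0, T]` under `t ↦ X_t(ω)`. -/
noncomputable def empirical (P : MarkovFamily E Ω) (T : ℝ) (ω : Ω) : Measure E :=
  ENNReal.ofReal (1 / T) •
    ((volume : Measure ℝ).restrict (Set.Ioc 0 T)).map (fun t => P.X t.toNNReal ω)

end MarkovFamily

/-- The optimal transport cost
`𝒯_p(ν₀, ν₁) = inf { ∫ |x - y|^p π(dx, dy) : π a coupling of ν₀ and ν₁ }`. -/
noncomputable def transportCost {d : ℕ} (p : ℝ)
    (ν₀ ν₁ : Measure (EuclideanSpace ℝ (Fin d))) : ℝ≥0∞ :=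
  ⨅ (π : Measure (EuclideanSpace ℝ (Fin d) × EuclideanSpace ℝ (Fin d)))
    (_ : π.map Prod.fst = ν₀ ∧ π.map Prod.snd = ν₁),
    ∫⁻ z, edist z.1 z.2 ^ p ∂π

/-- The exponent `γ₂ = max {1/2, 1 - p/d}`. -/
noncomputable def gammaTwo (p : ℝ) (d : ℕ) : ℝ := max (1 / 2) (1 - p / d)

/-! Coercivity yields a variance bound for occupation times, and a multiscale coupling turns it into
a transport bound.

Variance. For bounded centred `f` put `g_t = ∫_0^t P_s f ds`. Strong continuity of the semigroup on
such `f` (`tendsto_integral_sq_semigroup_sub`) puts `g_t` in the domain of the generator, with `ℒ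
g_t = P_t f - f` (`hasGenerator_potential`). Coercivity applied to `g_t` gives `‖g_t‖ ≤ (2/λ)‖f‖`,
hence `⟨f, g_t⟩ ≤ (2/λ)‖f‖²` uniformly in `t`; neither symmetry nor exponential decay of the
semigroup is needed. By stationarity the variance of `∫_0^T f(X_t) dt` is a double integral of
covariances, so it is at most `(4/λ) T ‖f‖²` (`integral_sq_occupation_le`). With `f = 1_A - μ(A)`
this gives `𝔼|μ_T(A) - μ(A)| ≤ √(4 μ(A) / (λ T))`.

Coupling. Along refining partitions, match as much mass as possible inside the finest cells, then
match the leftovers inside the parent cells, and so on up to the whole space. What remains in a cell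
is exactly the difference of its two masses, so the cost is controlled by cell diameters times cell
discrepancies (`exists_coupling_lintegral_le`). The cells are cubes of side `2^(n-k)` inside the
ring `‖x‖ ≈ 2^n` (`transportCost_le`).

Rates. The `n`-th ring has mass `O(ε)`, `ε = 2^(-qn)`, and at most `3^d 2^(dk)` cells of level `k`.
By Cauchy-Schwarz their total expected discrepancy is of order `ε min(1, 2^(dk/2) (εT)^(-1/2))`.
Weighting by `2^(p(n-k))` and summing over `k` produces `γ₂`, with a logarithm at `p = d/2`
(`exists_sum_scales_le`); summing over `n` produces `max(γ₂, p/q)`, with a logarithm at `γ₂ q = p`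
(`exists_sum_rings_le`). Both are sums `∑ rⁿ min(1, sⁿ y)`, whose size depends on whether `r s` is
below, at or above `1`. -/

namespace MarkovFamily

/-! ### Transition kernels and two-time laws. -/

variable {E Ω : Type*} [MeasurableSpace E] [MeasurableSpace Ω]

instance instIsMarkovKernelLaw (P : MarkovFamily E Ω) : IsMarkovKernel P.law :=
  P.isMarkovKernel_law

lemma measurable_X_apply (P : MarkovFamily E Ω) (t : ℝ≥0) : Measurable (P.X t) :=
  P.measurable_X.comp (measurable_const.prodMk measurable_id)

lemma measurable_path (P : MarkovFamily E Ω) (ω : Ω) :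
    Measurable fun t : ℝ => P.X t.toNNReal ω :=
  P.measurable_X.comp ((measurable_real_toNNReal.comp measurable_id).prodMk measurable_const)

/-- The transition kernel `P_t(x, ·)`, the law of `X_t` under `ℙ^x`. -/
noncomputable def transition (P : MarkovFamily E Ω) (t : ℝ≥0) : Kernel E E :=
  P.law.map (P.X t)

instance instIsMarkovKernelTransition (P : MarkovFamily E Ω) (t : ℝ≥0) :
    IsMarkovKernel (P.transition t) :=
  Kernel.IsMarkovKernel.map _ (P.measurable_X_apply t)

lemma transition_apply (P : MarkovFamily E Ω) (t : ℝ≥0) (x : E) :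
    P.transition t x = (P.law x).map (P.X t) :=
  Kernel.map_apply _ (P.measurable_X_apply t) x

/-- The past of the process up to time `t`. -/
abbrev past (P : MarkovFamily E Ω) (t : ℝ≥0) : MeasurableSpace Ω :=
  ⨆ (r : ℝ≥0) (_ : r ≤ t), MeasurableSpace.comap (P.X r) inferInstance

lemma past_le (P : MarkovFamily E Ω) (t : ℝ≥0) : P.past t ≤ (inferInstance : MeasurableSpace Ω) :=
  iSup₂_le fun r _ => (P.measurable_X_apply r).comap_le

/-- The two-time Markov property under `ℙ^x`. -/
lemma map_pair_law (P : MarkovFamily E Ω) (x : E) (s r : ℝ≥0) :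
    (P.law x).map (fun ω => (P.X s ω, P.X (s + r) ω)) =
      (P.transition s x) ⊗ₘ (P.transition r) := by
  have hm : Measurable fun ω => (P.X s ω, P.X (s + r) ω) :=
    (P.measurable_X_apply s).prodMk (P.measurable_X_apply (s + r))
  have : IsProbabilityMeasure ((P.law x).map (fun ω => (P.X s ω, P.X (s + r) ω))) :=
    Measure.isProbabilityMeasure_map hm.aemeasurable
  refine Measure.ext_prod fun {A B} hA hB => ?_
  rw [Measure.map_apply hm (hA.prod hB), Measure.compProd_apply_prod hA hB,
    transition_apply, setLIntegral_map hA (Kernel.measurable_coe _ hB) (P.measurable_X_apply s)]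
  have hAs : MeasurableSet[P.past s] (P.X s ⁻¹' A) :=
    (le_iSup₂_of_le (f := fun (r : ℝ≥0) (_ : r ≤ s) =>
      MeasurableSpace.comap (P.X r) inferInstance) s le_rfl le_rfl) _ ⟨A, hA, rfl⟩
  have hBm : MeasurableSet (P.X (s + r) ⁻¹' B) := P.measurable_X_apply _ hB
  have hint : Integrable ((P.X (s + r) ⁻¹' B).indicator fun _ => (1 : ℝ)) (P.law x) :=
    (integrable_const _).indicator hBm
  -- The event `{X_s ∈ A}` lies in the past of `s`, so the conditional expectation in the Markov
  -- property may be integrated over it.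
  have h1 := setIntegral_condExp (P.past_le s) hint hAs
  rw [setIntegral_congr_ae (g := fun ω => (P.law (P.X s ω)).real (P.X r ⁻¹' B))
    (P.past_le s _ hAs) ((P.markov x r s B hB).mono fun ω h _ => h),
    integral_indicator hBm, Measure.restrict_restrict hBm, setIntegral_const, smul_eq_mul,
    mul_one] at h1
  have h2 : ∀ ω, (P.law (P.X s ω)).real (P.X r ⁻¹' B) =
      (P.transition r (P.X s ω)).real B := fun ω => by
    rw [transition_apply, map_measureReal_apply (P.measurable_X_apply r) hB]
  simp_rw [h2] at h1
  have hmeas : Measurable fun ω => P.transition r (P.X s ω) B :=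
    (Kernel.measurable_coe _ hB).comp (P.measurable_X_apply s)
  have h3 : ENNReal.ofReal (∫ ω in P.X s ⁻¹' A, (P.transition r (P.X s ω)).real B ∂(P.law x)) =
      ∫⁻ ω in P.X s ⁻¹' A, P.transition r (P.X s ω) B ∂(P.law x) := by
    simp_rw [measureReal_def]
    rw [integral_toReal hmeas.aemeasurable (ae_of_all _ fun ω => measure_lt_top _ _),
      ENNReal.ofReal_toReal]
    refine ne_of_lt ((lintegral_mono fun ω => prob_le_one).trans_lt ?_)
    simp
  rw [← h3, h1, ofReal_measureReal]
  congr 1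
  ext ω
  simp [and_comm]

lemma isProbabilityMeasure_lawFrom (P : MarkovFamily E Ω) (μ : Measure E)
    [IsProbabilityMeasure μ] : IsProbabilityMeasure (P.lawFrom μ) := by
  unfold lawFrom; infer_instance

lemma bind_transition {P : MarkovFamily E Ω} {μ : Measure E} (hinv : P.IsInvariant μ) (t : ℝ≥0) :
    μ.bind (P.transition t) = μ := hinv t

/-- Under the stationary law, the law of `(X_s, X_{s+r})` is `μ ⊗ P_r`. -/
lemma map_pair_lawFrom (P : MarkovFamily E Ω) {μ : Measure E} [IsProbabilityMeasure μ]
    (hinv : P.IsInvariant μ) (s r : ℝ≥0) :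
    (P.lawFrom μ).map (fun ω => (P.X s ω, P.X (s + r) ω)) = μ ⊗ₘ (P.transition r) := by
  have hm : Measurable fun ω => (P.X s ω, P.X (s + r) ω) :=
    (P.measurable_X_apply s).prodMk (P.measurable_X_apply (s + r))
  ext A hA
  rw [Measure.map_apply hm hA, lawFrom, Measure.bind_apply (hm hA) P.law.aemeasurable,
    Measure.compProd_apply hA]
  have : ∀ x, P.law x ((fun ω => (P.X s ω, P.X (s + r) ω)) ⁻¹' A) =
      ∫⁻ y, P.transition r y (Prod.mk y ⁻¹' A) ∂(P.transition s x) := fun x => by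
    rw [← Measure.map_apply hm hA, map_pair_law, Measure.compProd_apply hA]
  simp_rw [this]
  rw [← Measure.lintegral_bind (P.transition s).aemeasurable, bind_transition hinv]
  exact (Kernel.measurable_kernel_prodMk_left hA).aemeasurable

lemma map_X_lawFrom (P : MarkovFamily E Ω) {μ : Measure E} [IsProbabilityMeasure μ]
    (hinv : P.IsInvariant μ) (s : ℝ≥0) : (P.lawFrom μ).map (P.X s) = μ := by
  have h := congrArg Measure.fst (P.map_pair_lawFrom hinv s 0)
  rwa [Measure.fst_compProd, Measure.fst_map_prodMk (P.measurable_X_apply _)] at h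

/-- The Chapman–Kolmogorov equation. -/
lemma bind_transition_apply (P : MarkovFamily E Ω) (s r : ℝ≥0) (x : E) :
    (P.transition s x).bind (P.transition r) = P.transition (s + r) x := by
  have h := congrArg Measure.snd (P.map_pair_law x s r)
  rw [Measure.snd_compProd, Measure.snd_map_prodMk (P.measurable_X_apply _)] at h
  rw [← h, transition_apply]

lemma semigroup_eq (P : MarkovFamily E Ω) (t : ℝ≥0) {f : E → ℝ} (hf : Measurable f) (x : E) :
    P.semigroup t f x = ∫ y, f y ∂(P.transition t x) := by
  rw [transition_apply, integral_map (P.measurable_X_apply t).aemeasurable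
    hf.aestronglyMeasurable]
  rfl

lemma abs_semigroup_le (P : MarkovFamily E Ω) (t : ℝ≥0) {f : E → ℝ} {M : ℝ}
    (hM : ∀ x, |f x| ≤ M) (x : E) : |P.semigroup t f x| ≤ M := by
  have := norm_integral_le_of_norm_le_const (μ := P.law x) (f := fun ω => f (P.X t ω))
    (ae_of_all _ fun ω => hM _)
  simpa [semigroup] using this

lemma measurable_semigroup (P : MarkovFamily E Ω) {f : E → ℝ} (hf : Measurable f) :
    Measurable fun z : ℝ × E => P.semigroup z.1.toNNReal f z.2 := by
  have h : StronglyMeasurable fun w : (ℝ × E) × Ω => f (P.X w.1.1.toNNReal w.2) := by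
    have h : Measurable fun w : (ℝ × E) × Ω => (w.1.1.toNNReal, w.2) :=
      (measurable_real_toNNReal.comp (measurable_fst.comp measurable_fst)).prodMk measurable_snd
    exact ((hf.comp P.measurable_X).comp h).stronglyMeasurable
  exact (h.integral_kernel_prod_right' (κ := Kernel.prodMkLeft ℝ P.law)).measurable

lemma measurable_semigroup_apply (P : MarkovFamily E Ω) (t : ℝ≥0) {f : E → ℝ}
    (hf : Measurable f) : Measurable (P.semigroup t f) := by
  have := (P.measurable_semigroup hf).comp (measurable_prodMk_left (x := (t : ℝ)))
  simpa [Function.comp_def] using this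

end MarkovFamily

/-! ### Strong continuity of the semigroup in `L²(μ)`. -/

/-- Translations act continuously on `L¹(ℝ)`. -/
lemma tendsto_integral_abs_translate_sub {v : ℝ → ℝ} (hv : Integrable v) :
    Tendsto (fun h : ℝ => ∫ t, |v (t + h) - v t|) (𝓝 0) (𝓝 0) := by
  let g : ℝ → C(ℝ, ℝ) := fun h => ⟨fun t => t + h, by fun_prop⟩
  have hg : Continuous g :=
    ContinuousMap.continuous_of_continuous_uncurry _
      (continuous_snd.add continuous_fst)
  have hgm : ∀ h, MeasurePreserving (g h) (volume : Measure ℝ) volume := fun h =>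
    measurePreserving_add_right volume h
  have hv1 : MemLp v 1 volume := memLp_one_iff_integrable.2 hv
  have hc := (continuous_const (y := hv1.toLp v)).compMeasurePreservingLp hg hgm ENNReal.one_ne_top
  have hT := (hc.tendsto 0).dist (tendsto_const_nhds (x := hv1.toLp v))
  have h0 : Lp.compMeasurePreserving (g 0) (hgm 0) (hv1.toLp v) = hv1.toLp v := by
    rw [Lp.toLp_compMeasurePreserving]
    congr 1
    ext t
    simp [g]
  rw [h0, dist_self] at hT
  refine hT.congr fun h => ?_
  rw [Lp.toLp_compMeasurePreserving, dist_eq_norm, ← MemLp.toLp_sub, L1.norm_eq_integral_norm]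
  refine integral_congr_ae ?_
  filter_upwards [MemLp.coeFn_toLp ((hv1.comp_measurePreserving (hgm h)).sub hv1)] with t ht
  rw [ht]
  simp [g, Real.norm_eq_abs]

lemma tendsto_setIntegral_abs_translate_sub {v : ℝ → ℝ} (hv : Measurable v) {M : ℝ}
    (hM : ∀ t, |v t| ≤ M) :
    Tendsto (fun h : ℝ≥0 => ∫ t in Set.Ioc (0 : ℝ) 1, |v (t + h) - v t|) (𝓝 0) (𝓝 0) := by
  -- The cutoff reaches `2` so that `t + h` stays in the window for `t ≤ 1` and `h ≤ 1`.
  let w : ℝ → ℝ := (Set.Icc (0 : ℝ) 2).indicator v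
  have hw : Integrable w := by
    rw [integrable_indicator_iff measurableSet_Icc]
    exact Measure.integrableOn_of_bounded (by simp) hv.aestronglyMeasurable
      (ae_of_all _ fun t => hM t)
  have h1 := (tendsto_integral_abs_translate_sub hw).comp
    (NNReal.continuous_coe.tendsto' 0 0 rfl)
  refine tendsto_of_tendsto_of_tendsto_of_le_of_le' tendsto_const_nhds h1
    (Eventually.of_forall fun h => integral_nonneg fun t => abs_nonneg _) ?_
  filter_upwards [Iic_mem_nhds (show (0 : ℝ≥0) < 1 by norm_num)] with h hh
  have hh1 : (h : ℝ) ≤ 1 := by exact_mod_cast hh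
  have hh0 : (0 : ℝ) ≤ h := h.2
  have hint : Integrable fun t => |w (t + h) - w t| :=
    ((hw.comp_add_right (h : ℝ)).sub hw).abs
  rw [setIntegral_congr_fun (g := fun t => |w (t + h) - w t|) measurableSet_Ioc]
  · exact setIntegral_le_integral hint (ae_of_all _ fun t => abs_nonneg _)
  · intro t ht
    have e1 : w t = v t := Set.indicator_of_mem (Set.mem_Icc.2 ⟨ht.1.le, by linarith [ht.2]⟩) _
    have e2 : w (t + h) = v (t + h) :=
      Set.indicator_of_mem (Set.mem_Icc.2 ⟨by linarith [ht.1], by linarith [ht.2]⟩) _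
    simp only [e1, e2]

lemma integrable_of_abs_le {α : Type*} [MeasurableSpace α] {ν : Measure α} [IsFiniteMeasure ν]
    {u : α → ℝ} (hu : Measurable u) {M : ℝ} (hM : ∀ x, |u x| ≤ M) : Integrable u ν :=
  Integrable.of_bound hu.aestronglyMeasurable M (ae_of_all _ hM)

lemma integrable_sq_of_abs_le {α : Type*} [MeasurableSpace α] {ν : Measure α} [IsFiniteMeasure ν]
    {u : α → ℝ} (hu : Measurable u) {M : ℝ} (hM : ∀ x, |u x| ≤ M) :
    Integrable (fun x => u x ^ 2) ν :=
  integrable_of_abs_le (M := M ^ 2) (by fun_prop) fun x => by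
    rw [abs_pow]; exact pow_le_pow_left₀ (abs_nonneg _) (hM x) 2

/-- Nonnegativity of the variance. -/
lemma sq_integral_le_integral_sq {α : Type*} [MeasurableSpace α] {ν : Measure α}
    [IsProbabilityMeasure ν] {u : α → ℝ} (hu : Measurable u) {M : ℝ} (hM : ∀ x, |u x| ≤ M) :
    (∫ x, u x ∂ν) ^ 2 ≤ ∫ x, u x ^ 2 ∂ν := by
  set m := ∫ x, u x ∂ν with hm
  have h1 : Integrable u ν := integrable_of_abs_le hu hM
  have h2 : Integrable (fun x => u x ^ 2) ν := integrable_sq_of_abs_le hu hM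
  have h : 0 ≤ ∫ x, (u x - m) ^ 2 ∂ν := integral_nonneg fun x => sq_nonneg _
  have e : (fun x => (u x - m) ^ 2) = fun x => u x ^ 2 - ((2 * m) * u x - m ^ 2) := by
    ext x; ring
  have h3 : Integrable (fun x => (2 * m) * u x - m ^ 2) ν :=
    (h1.const_mul _).sub (integrable_const _)
  rw [e, integral_sub h2 h3, integral_sub (h1.const_mul _) (integrable_const _),
    integral_const_mul, ← hm] at h
  simp at h
  nlinarith

lemma abs_sub_le_two_mul {a b M : ℝ} (ha : |a| ≤ M) (hb : |b| ≤ M) : |a - b| ≤ 2 * M :=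
  (abs_sub a b).trans (by linarith)

namespace MarkovFamily

variable {E Ω : Type*} [MeasurableSpace E] [MeasurableSpace Ω]

/-- The transition semigroup is strongly continuous at `0` in `L²(μ)`. -/
lemma tendsto_integral_sq_semigroup_sub (P : MarkovFamily E Ω) {μ : Measure E}
    [IsProbabilityMeasure μ] (hinv : P.IsInvariant μ) {f : E → ℝ} (hf : Measurable f) {M : ℝ}
    (hM : ∀ x, |f x| ≤ M) :
    Tendsto (fun h : ℝ≥0 => ∫ x, (P.semigroup h f x - f x) ^ 2 ∂μ) (𝓝 0) (𝓝 0) := by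
  have : IsProbabilityMeasure (P.lawFrom μ) := P.isProbabilityMeasure_lawFrom μ
  let D : ℝ≥0 → ℝ → Ω → ℝ := fun h t ω => f (P.X (t + h).toNNReal ω) - f (P.X t.toNNReal ω)
  have hDb : ∀ h t ω, |D h t ω| ≤ 2 * M := fun h t ω => abs_sub_le_two_mul (hM _) (hM _)
  have hDm : ∀ h, Measurable (Function.uncurry (D h)) := fun h => by
    have h1 : Measurable fun z : ℝ × Ω => ((z.1 + h).toNNReal, z.2) :=
      (measurable_real_toNNReal.comp (measurable_fst.add_const _)).prodMk measurable_snd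
    have h2 : Measurable fun z : ℝ × Ω => (z.1.toNNReal, z.2) :=
      (measurable_real_toNNReal.comp measurable_fst).prodMk measurable_snd
    exact ((hf.comp P.measurable_X).comp h1).sub ((hf.comp P.measurable_X).comp h2)
  have hDmω : ∀ h ω, Measurable fun t => D h t ω := fun h ω => (hDm h).comp measurable_prodMk_right
  have hfm : Measurable fun z : E × E => f z.2 - f z.1 :=
    (hf.comp measurable_snd).sub (hf.comp measurable_fst)
  -- Jensen for `P_h(x, ·)` bounds the left side by the stationary second moment of `f(X_{t+h}) -
  -- f(X_t)`. This moment does not depend on `t`, so it may be averaged over `t ∈ (0, 1]`;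
  -- translation continuity along each path then applies, and joint measurability replaces any path
  -- regularity.
  have hbound : ∀ h : ℝ≥0, ∫ x, (P.semigroup h f x - f x) ^ 2 ∂μ ≤
      ∫ ω, (∫ t in Set.Ioc (0 : ℝ) 1, D h t ω ^ 2) ∂(P.lawFrom μ) := by
    intro h
    have hA : ∫ x, (P.semigroup h f x - f x) ^ 2 ∂μ ≤
        ∫ z, (f z.2 - f z.1) ^ 2 ∂(μ ⊗ₘ P.transition h) := by
      have hi : Integrable (fun z : E × E => (f z.2 - f z.1) ^ 2) (μ ⊗ₘ P.transition h) :=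
        integrable_sq_of_abs_le hfm fun z => abs_sub_le_two_mul (hM _) (hM _)
      rw [Measure.integral_compProd hi]
      refine integral_mono ?_ hi.integral_compProd fun x => ?_
      · exact integrable_sq_of_abs_le ((P.measurable_semigroup_apply h hf).sub hf) fun z =>
          abs_sub_le_two_mul (P.abs_semigroup_le h hM z) (hM _)
      · have e : P.semigroup h f x - f x = ∫ y, (f y - f x) ∂(P.transition h x) := by
          rw [P.semigroup_eq h hf, integral_sub (integrable_of_abs_le hf hM) (integrable_const _)]
          simp
        simp only [e]
        exact sq_integral_le_integral_sq (hf.sub_const _) fun y =>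
          abs_sub_le_two_mul (hM _) (hM _)
    have hA' : ∀ t ∈ Set.Ioc (0 : ℝ) 1, ∫ ω, D h t ω ^ 2 ∂(P.lawFrom μ) =
        ∫ z, (f z.2 - f z.1) ^ 2 ∂(μ ⊗ₘ P.transition h) := by
      intro t ht
      rw [← P.map_pair_lawFrom hinv t.toNNReal h, integral_map
        ((P.measurable_X_apply _).prodMk (P.measurable_X_apply _)).aemeasurable
        (hfm.pow_const 2).aestronglyMeasurable]
      refine integral_congr_ae (ae_of_all _ fun ω => ?_)
      simp only [D]
      rw [Real.toNNReal_add ht.1.le h.coe_nonneg, Real.toNNReal_coe]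
    refine hA.trans (le_of_eq ?_)
    rw [integral_integral_swap]
    · rw [setIntegral_congr_fun measurableSet_Ioc hA']
      simp
    · exact integrable_sq_of_abs_le (u := fun z : Ω × ℝ => D h z.2 z.1)
        ((hDm h).comp measurable_swap) fun z => hDb _ _ _
  refine tendsto_of_tendsto_of_tendsto_of_le_of_le tendsto_const_nhds ?_
    (fun h => integral_nonneg fun x => sq_nonneg _) hbound
  suffices H : Tendsto (fun h : ℝ≥0 => ∫ ω, (∫ t in Set.Ioc (0 : ℝ) 1, D h t ω ^ 2) ∂(P.lawFrom μ))
      (𝓝 0) (𝓝 (∫ _, (0 : ℝ) ∂(P.lawFrom μ))) by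
    rwa [integral_zero] at H
  refine tendsto_integral_filter_of_dominated_convergence (fun _ => (2 * M) ^ 2)
    (Eventually.of_forall fun h => ?_) (Eventually.of_forall fun h => ae_of_all _ fun ω => ?_)
    (integrable_const _) (ae_of_all _ fun ω => ?_)
  · have : StronglyMeasurable fun z : Ω × ℝ => D h z.2 z.1 ^ 2 :=
      (((hDm h).comp measurable_swap).pow_const 2).stronglyMeasurable
    exact this.integral_prod_right'.aestronglyMeasurable
  · refine (norm_integral_le_of_norm_le_const (C := (2 * M) ^ 2) (ae_of_all _ fun t => ?_)).trans
      (by simp)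
    rw [Real.norm_eq_abs, abs_pow]
    exact pow_le_pow_left₀ (abs_nonneg _) (hDb _ _ _) 2
  · have hM0 : 0 ≤ M := (abs_nonneg _).trans (hM (P.X 0 ω))
    have hv : Measurable fun t : ℝ => f (P.X t.toNNReal ω) := hf.comp (P.measurable_path ω)
    -- Boundedness reduces the squared increment to `2M` times its absolute value.
    have h1 := (tendsto_setIntegral_abs_translate_sub hv fun t => hM _).const_mul (2 * M)
    rw [mul_zero] at h1
    refine tendsto_of_tendsto_of_tendsto_of_le_of_le tendsto_const_nhds h1
      (fun h => integral_nonneg fun x => sq_nonneg _) fun h => ?_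
    simp only
    rw [← integral_const_mul]
    refine integral_mono (integrable_sq_of_abs_le (hDmω h ω) fun t => hDb h t ω)
      ((integrable_of_abs_le (hDmω h ω) fun t => hDb h t ω).abs.const_mul _) fun t => ?_
    simp only
    rw [← sq_abs, sq]
    exact mul_le_mul_of_nonneg_right (hDb h t ω) (abs_nonneg _)

end MarkovFamily

/-! ### Truncated potentials, the generator and coercivity. -/

lemma integral_bind_of_abs_le {α β : Type*} [MeasurableSpace α] [MeasurableSpace β]
    (ν : Measure α) [IsFiniteMeasure ν] (κ : Kernel α β) [IsMarkovKernel κ] {f : β → ℝ}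
    (hf : Measurable f) {M : ℝ} (hM : ∀ x, |f x| ≤ M) :
    ∫ y, f y ∂(ν.bind κ) = ∫ x, ∫ y, f y ∂(κ x) ∂ν := by
  rw [← Measure.snd_compProd, Measure.snd, integral_map measurable_snd.aemeasurable
    hf.aestronglyMeasurable, Measure.integral_compProd]
  exact integrable_of_abs_le (hf.comp measurable_snd) fun z => hM _

lemma intervalIntegrable_of_abs_le {u : ℝ → ℝ} (hu : Measurable u) {M : ℝ}
    (hM : ∀ x, |u x| ≤ M) (a b : ℝ) : IntervalIntegrable u volume a b := by
  rw [intervalIntegrable_iff]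
  have : IsFiniteMeasure ((volume : Measure ℝ).restrict (Set.uIoc a b)) :=
    ⟨by simp [Set.uIoc]⟩
  exact integrable_of_abs_le hu hM

lemma sq_abs_le {a M : ℝ} (h : |a| ≤ M) : |a ^ 2| ≤ M ^ 2 := by
  rw [abs_pow]; exact pow_le_pow_left₀ (abs_nonneg _) h 2

namespace MarkovFamily

variable {E Ω : Type*} [MeasurableSpace E] [MeasurableSpace Ω]

lemma integral_semigroup (P : MarkovFamily E Ω) {μ : Measure E} [IsProbabilityMeasure μ]
    (hinv : P.IsInvariant μ) (t : ℝ≥0) {f : E → ℝ} (hf : Measurable f) {M : ℝ}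
    (hM : ∀ x, |f x| ≤ M) : ∫ x, P.semigroup t f x ∂μ = ∫ x, f x ∂μ := by
  simp_rw [P.semigroup_eq t hf]
  rw [← integral_bind_of_abs_le μ (P.transition t) hf hM, bind_transition hinv]

/-- Jensen gives `(P_t f)² ≤ P_t (f²)`, and invariance removes `P_t` after integration. -/
lemma integral_sq_semigroup_le (P : MarkovFamily E Ω) {μ : Measure E} [IsProbabilityMeasure μ]
    (hinv : P.IsInvariant μ) (t : ℝ≥0) {f : E → ℝ} (hf : Measurable f) {M : ℝ}
    (hM : ∀ x, |f x| ≤ M) : ∫ x, P.semigroup t f x ^ 2 ∂μ ≤ ∫ x, f x ^ 2 ∂μ := by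
  have hf2 : Measurable fun x => f x ^ 2 := hf.pow_const 2
  rw [← P.integral_semigroup hinv t hf2 (fun x => sq_abs_le (hM x))]
  refine integral_mono
    (integrable_sq_of_abs_le (P.measurable_semigroup_apply t hf) (P.abs_semigroup_le t hM))
    (integrable_of_abs_le (P.measurable_semigroup_apply t hf2)
      (P.abs_semigroup_le t fun x => sq_abs_le (hM x))) fun x => ?_
  simp only [P.semigroup_eq t hf, P.semigroup_eq t hf2]
  exact sq_integral_le_integral_sq hf hM

lemma semigroup_semigroup (P : MarkovFamily E Ω) (h s : ℝ≥0) {f : E → ℝ} (hf : Measurable f)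
    {M : ℝ} (hM : ∀ x, |f x| ≤ M) (x : E) :
    P.semigroup h (P.semigroup s f) x = P.semigroup (h + s) f x := by
  rw [P.semigroup_eq h (P.measurable_semigroup_apply s hf), P.semigroup_eq _ hf,
    ← bind_transition_apply, integral_bind_of_abs_le _ _ hf hM]
  simp_rw [P.semigroup_eq s hf]

lemma semigroup_sub (P : MarkovFamily E Ω) (t : ℝ≥0) {f g : E → ℝ} (hf : Measurable f)
    (hg : Measurable g) {M N : ℝ} (hM : ∀ x, |f x| ≤ M) (hN : ∀ x, |g x| ≤ N) (x : E) :
    P.semigroup t (fun y => f y - g y) x = P.semigroup t f x - P.semigroup t g x := by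
  rw [P.semigroup_eq t (f := fun y => f y - g y) (hf.sub hg), P.semigroup_eq t hf, P.semigroup_eq t hg]
  exact integral_sub (integrable_of_abs_le hf hM) (integrable_of_abs_le hg hN)

/-- The truncated potential `g_t = ∫_0^t P_s f ds`. -/
noncomputable def potential (P : MarkovFamily E Ω) (f : E → ℝ) (t : ℝ) (x : E) : ℝ :=
  ∫ s in (0 : ℝ)..t, P.semigroup s.toNNReal f x

lemma measurable_semigroup_time (P : MarkovFamily E Ω) {f : E → ℝ} (hf : Measurable f) (x : E) :
    Measurable fun s : ℝ => P.semigroup s.toNNReal f x :=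
  (P.measurable_semigroup hf).comp measurable_prodMk_right

lemma intervalIntegrable_semigroup (P : MarkovFamily E Ω) {f : E → ℝ} (hf : Measurable f) {M : ℝ}
    (hM : ∀ x, |f x| ≤ M) (x : E) (a b : ℝ) :
    IntervalIntegrable (fun s : ℝ => P.semigroup s.toNNReal f x) volume a b :=
  intervalIntegrable_of_abs_le (P.measurable_semigroup_time hf x)
    (fun _ => P.abs_semigroup_le _ hM x) a b

lemma abs_potential_le (P : MarkovFamily E Ω) {f : E → ℝ} {M : ℝ}
    (hM : ∀ x, |f x| ≤ M) {t : ℝ} (ht : 0 ≤ t) (x : E) : |P.potential f t x| ≤ M * t := by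
  have := intervalIntegral.norm_integral_le_of_norm_le_const (a := 0) (b := t) (C := M)
    (f := fun s : ℝ => P.semigroup s.toNNReal f x) fun s _ => P.abs_semigroup_le _ hM x
  rwa [sub_zero, abs_of_nonneg ht] at this

lemma measurable_potential (P : MarkovFamily E Ω) {f : E → ℝ} (hf : Measurable f) {t : ℝ}
    (ht : 0 ≤ t) : Measurable (P.potential f t) := by
  have : StronglyMeasurable fun z : E × ℝ => P.semigroup z.2.toNNReal f z.1 :=
    ((P.measurable_semigroup hf).comp measurable_swap).stronglyMeasurable
  have h := (this.integral_prod_right' (ν := volume.restrict (Set.Ioc 0 t))).measurable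
  convert h using 2 with x
  exact intervalIntegral.integral_of_le ht

lemma integral_mul_potential (P : MarkovFamily E Ω) {f φ : E → ℝ} (hf : Measurable f) {M N : ℝ}
    (hM : ∀ x, |f x| ≤ M) (hφ : Measurable φ) (hN : ∀ x, |φ x| ≤ N) {t : ℝ}
    (ht : 0 ≤ t) (ν : Measure E) [IsFiniteMeasure ν] :
    ∫ x, φ x * P.potential f t x ∂ν =
      ∫ s in (0 : ℝ)..t, (∫ x, φ x * P.semigroup s.toNNReal f x ∂ν) := by
  simp_rw [potential, ← intervalIntegral.integral_const_mul, intervalIntegral.integral_of_le ht]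
  refine integral_integral_swap (f := fun x (s : ℝ) => φ x * P.semigroup s.toNNReal f x) ?_
  refine integrable_of_abs_le (M := N * M) ?_ fun z => ?_
  · exact (hφ.comp measurable_fst).mul ((P.measurable_semigroup hf).comp measurable_swap)
  · simp only [Function.uncurry, abs_mul]
    exact mul_le_mul (hN _) (P.abs_semigroup_le _ hM _) (abs_nonneg _)
      ((abs_nonneg _).trans (hN z.1))

lemma integral_potential (P : MarkovFamily E Ω) {f : E → ℝ} (hf : Measurable f) {M : ℝ}
    (hM : ∀ x, |f x| ≤ M) {t : ℝ} (ht : 0 ≤ t) (ν : Measure E) [IsFiniteMeasure ν] :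
    ∫ x, P.potential f t x ∂ν =
      ∫ s in (0 : ℝ)..t, (∫ x, P.semigroup s.toNNReal f x ∂ν) := by
  simpa using P.integral_mul_potential hf hM (φ := fun _ => 1) measurable_const
    (N := 1) (by simp) ht ν

lemma semigroup_potential (P : MarkovFamily E Ω) {f : E → ℝ} (hf : Measurable f) {M : ℝ}
    (hM : ∀ x, |f x| ≤ M) (h : ℝ≥0) {t : ℝ} (ht : 0 ≤ t) (x : E) :
    P.semigroup h (P.potential f t) x =
      ∫ s in (0 : ℝ)..t, P.semigroup (s + h).toNNReal f x := by
  rw [P.semigroup_eq h (P.measurable_potential hf ht), P.integral_potential hf hM ht,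
    intervalIntegral.integral_of_le ht, intervalIntegral.integral_of_le ht]
  refine setIntegral_congr_fun measurableSet_Ioc fun s hs => ?_
  rw [← P.semigroup_eq h (P.measurable_semigroup_apply _ hf), P.semigroup_semigroup _ _ hf hM,
    Real.toNNReal_add hs.1.le h.coe_nonneg, Real.toNNReal_coe, add_comm]

/-- The difference quotient of the potential as an average over the unit interval. -/
lemma semigroup_potential_sub_div (P : MarkovFamily E Ω) {f : E → ℝ} (hf : Measurable f) {M : ℝ}
    (hM : ∀ x, |f x| ≤ M) {h : ℝ≥0} (hh : 0 < h) (t : ℝ≥0) (x : E) :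
    (P.semigroup h (P.potential f t) x - P.potential f t x) / (h : ℝ) =
      ∫ r in (0 : ℝ)..1, (P.semigroup t (P.semigroup (h * r).toNNReal f) x
        - P.semigroup (h * r).toNNReal f x) := by
  have hi := P.intervalIntegrable_semigroup hf hM x
  have hh' : (h : ℝ) ≠ 0 := by exact_mod_cast hh.ne'
  have e1 : ∀ r ∈ Set.uIcc (0 : ℝ) 1, P.semigroup t (P.semigroup (h * r).toNNReal f) x
      - P.semigroup (h * r).toNNReal f x =
      P.semigroup (h * r + t).toNNReal f x - P.semigroup (h * r).toNNReal f x := by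
    intro r hr
    rw [Set.uIcc_of_le zero_le_one] at hr
    rw [P.semigroup_semigroup _ _ hf hM, Real.toNNReal_add (mul_nonneg h.coe_nonneg hr.1)
      t.coe_nonneg, Real.toNNReal_coe, add_comm t]
  -- After `s = h r` the right side is `h⁻¹ (∫_t^{t+h} - ∫_0^h) P_s f ds`, and the left side is `h⁻¹
  -- (∫_h^{t+h} - ∫_0^t) P_s f ds`; these agree by additivity over intervals.
  rw [intervalIntegral.integral_congr e1, intervalIntegral.integral_comp_mul_left
    (f := fun s : ℝ => P.semigroup (s + t).toNNReal f x - P.semigroup s.toNNReal f x) hh',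
    mul_zero, mul_one, intervalIntegral.integral_sub _ (hi _ _),
    intervalIntegral.integral_comp_add_right (fun s : ℝ => P.semigroup s.toNNReal f x),
    P.semigroup_potential hf hM h t.coe_nonneg,
    intervalIntegral.integral_comp_add_right (fun s : ℝ => P.semigroup s.toNNReal f x), potential,
    smul_eq_mul, div_eq_inv_mul]
  · congr 1
    rw [zero_add, zero_add, add_comm (t : ℝ) h]
    exact intervalIntegral.integral_interval_sub_interval_comm' (hi _ _) (hi _ _) (hi _ _)
  · exact intervalIntegrable_of_abs_le
      ((P.measurable_semigroup_time hf x).comp (measurable_id.add_const (t : ℝ)))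
      (fun s => P.abs_semigroup_le _ hM x) _ _

/-- The error is the average over `r ∈ (0, 1]` of `P_t u_r - u_r`, where `u_r = P_{hr} f - f`.
Jensen in `r` and the `L²` contraction bound it by `‖u_r‖`, which is small uniformly in `r` because
`h r ≤ h`. -/
lemma tendsto_integral_sq_generator (P : MarkovFamily E Ω) {μ : Measure E}
    [IsProbabilityMeasure μ] (hinv : P.IsInvariant μ) {f : E → ℝ} (hf : Measurable f) {M : ℝ}
    (hM : ∀ x, |f x| ≤ M) (t : ℝ≥0) :
    Tendsto (fun h : ℝ≥0 => ∫ x, ((P.semigroup h (P.potential f t) x - P.potential f t x) / (h : ℝ)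
      - (P.semigroup t f x - f x)) ^ 2 ∂μ) (𝓝[>] 0) (𝓝 0) := by
  have hS := P.tendsto_integral_sq_semigroup_sub hinv hf hM
  have hPm := fun s => P.measurable_semigroup_apply s hf
  have hPb := fun s => P.abs_semigroup_le s hM
  rw [Metric.tendsto_nhds] at hS ⊢
  intro ε hε
  -- From `(a - b)² ≤ 2a² + 2b²` and contraction, `‖P_t u - u‖² ≤ 4‖u‖²`; thus `ε / 8` becomes `ε /
  -- 2`, which leaves the strict inequality.
  have hS' := hS (ε / 8) (by positivity)
  obtain ⟨δ, hδ, hball⟩ := Metric.eventually_nhds_iff.1 hS'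
  filter_upwards [self_mem_nhdsWithin, nhdsWithin_le_nhds (Metric.ball_mem_nhds (0 : ℝ≥0) hδ)]
    with h hpos hhδ
  have hu : ∀ r ∈ Set.Ioc (0 : ℝ) 1,
      ∫ x, (P.semigroup (h * r).toNNReal f x - f x) ^ 2 ∂μ ≤ ε / 8 := by
    intro r hr
    have := hball (y := (h * r).toNNReal) (by
      rw [Metric.mem_ball, NNReal.dist_eq, NNReal.coe_zero, sub_zero, abs_of_nonneg h.coe_nonneg]
        at hhδ
      rw [NNReal.dist_eq, NNReal.coe_zero, sub_zero, NNReal.abs_eq,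
        Real.coe_toNNReal _ (mul_nonneg h.coe_nonneg hr.1.le)]
      nlinarith [h.coe_nonneg, hr.1, hr.2])
    rw [Real.dist_eq, sub_zero] at this
    exact (le_abs_self _).trans this.le
  let u : ℝ → E → ℝ := fun r x => P.semigroup (h * r).toNNReal f x - f x
  let w : ℝ → E → ℝ := fun r x => P.semigroup t (u r) x - u r x
  have hum : ∀ r, Measurable (u r) := fun r => (hPm _).sub hf
  have hub : ∀ r x, |u r x| ≤ 2 * M := fun r x => abs_sub_le_two_mul (hPb _ _) (hM _)
  have hw : ∀ r x, w r x = (P.semigroup t (P.semigroup (h * r).toNNReal f) x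
      - P.semigroup (h * r).toNNReal f x) - (P.semigroup t f x - f x) := fun r x => by
    simp only [w, u]
    rw [P.semigroup_sub t (hPm _) hf (hPb _) hM]
    ring
  have hwm : Measurable (Function.uncurry w) := by
    have e : Function.uncurry w = fun z : ℝ × E => (P.semigroup (t + (h * z.1).toNNReal) f z.2
      - P.semigroup (h * z.1).toNNReal f z.2) - (P.semigroup t f z.2 - f z.2) := by
      ext z
      simp only [Function.uncurry]
      rw [hw, P.semigroup_semigroup _ _ hf hM]
    rw [e]
    have m1 : Measurable fun z : ℝ × E => (((t + (h * z.1).toNNReal : ℝ≥0) : ℝ), z.2) := by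
      fun_prop
    have m2 : Measurable fun z : ℝ × E => (h * z.1, z.2) := by fun_prop
    have m3 := (P.measurable_semigroup hf).comp m1
    simp only [Function.comp_def, Real.toNNReal_coe] at m3
    exact (m3.sub ((P.measurable_semigroup hf).comp m2)).sub
      (((hPm t).comp measurable_snd).sub (hf.comp measurable_snd))
  have hwb : ∀ r x, |w r x| ≤ 2 * (2 * M) := fun r x =>
    abs_sub_le_two_mul (P.abs_semigroup_le _ (hub r) x) (hub r x)
  have hw2 : ∀ r ∈ Set.Ioc (0 : ℝ) 1, ∫ x, w r x ^ 2 ∂μ ≤ ε / 2 := by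
    intro r hr
    have h1 := P.integral_sq_semigroup_le hinv t (hum r) (hub r)
    have h2 := hu r hr
    have i1 : Integrable (fun x => P.semigroup t (u r) x ^ 2) μ := integrable_sq_of_abs_le
      (P.measurable_semigroup_apply t (hum r)) (P.abs_semigroup_le _ (hub r))
    have i2 : Integrable (fun x => u r x ^ 2) μ := integrable_sq_of_abs_le (hum r) (hub r)
    have h3 : ∫ x, w r x ^ 2 ∂μ ≤ ∫ x, (2 * P.semigroup t (u r) x ^ 2 + 2 * u r x ^ 2) ∂μ :=
      integral_mono (integrable_sq_of_abs_le (hwm.comp measurable_prodMk_left) (hwb r))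
        ((i1.const_mul 2).add (i2.const_mul 2)) fun x => by
          simp only [w]
          nlinarith [sq_nonneg (P.semigroup t (u r) x + u r x)]
    rw [integral_add (i1.const_mul 2) (i2.const_mul 2), integral_const_mul,
      integral_const_mul] at h3
    linarith
  have hrep : ∀ x, (P.semigroup h (P.potential f t) x - P.potential f t x) / (h : ℝ)
      - (P.semigroup t f x - f x) = ∫ r in Set.Ioc (0 : ℝ) 1, w r x := by
    intro x
    rw [P.semigroup_potential_sub_div hf hM hpos, intervalIntegral.integral_of_le zero_le_one]
    simp_rw [hw]
    rw [integral_sub _ (integrable_const _)]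
    · simp
    · have e : (fun r : ℝ => P.semigroup t (P.semigroup (h * r).toNNReal f) x
          - P.semigroup (h * r).toNNReal f x) =
          fun r => w r x + (P.semigroup t f x - f x) := by
        ext r; rw [hw]; ring
      rw [e]
      exact (integrable_of_abs_le (hwm.comp measurable_prodMk_right) fun r => hwb r x).add
        (integrable_const _)
  simp_rw [hrep]
  rw [Real.dist_eq, sub_zero, abs_of_nonneg (integral_nonneg fun x => sq_nonneg _)]
  have hsw : Measurable fun z : E × ℝ => w z.2 z.1 := hwm.comp measurable_swap
  have hprob : IsProbabilityMeasure ((volume : Measure ℝ).restrict (Set.Ioc 0 1)) := ⟨by simp⟩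
  calc ∫ x, (∫ r in Set.Ioc (0 : ℝ) 1, w r x) ^ 2 ∂μ
      ≤ ∫ x, (∫ r in Set.Ioc (0 : ℝ) 1, w r x ^ 2) ∂μ := by
        refine integral_mono ?_ ?_ fun x => sq_integral_le_integral_sq
          (hwm.comp measurable_prodMk_right) fun r => hwb r x
        · refine integrable_sq_of_abs_le (M := 2 * (2 * M))
            (hsw.stronglyMeasurable.integral_prod_right').measurable fun x => ?_
          refine (norm_integral_le_of_norm_le_const (f := fun r => w r x) (C := 2 * (2 * M))
            (μ := volume.restrict (Set.Ioc (0 : ℝ) 1)) (ae_of_all _ fun r => hwb r x)).trans ?_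
          simp
        · exact (integrable_sq_of_abs_le (ν := μ.prod (volume.restrict (Set.Ioc (0 : ℝ) 1))) hsw
            fun z => hwb _ _).integral_prod_left
    _ = ∫ r in Set.Ioc (0 : ℝ) 1, (∫ x, w r x ^ 2 ∂μ) :=
        integral_integral_swap (f := fun x r => w r x ^ 2)
          (integrable_sq_of_abs_le (ν := μ.prod (volume.restrict (Set.Ioc (0 : ℝ) 1))) hsw
            fun z => hwb _ _)
    _ ≤ ∫ r in Set.Ioc (0 : ℝ) 1, ε / 2 := by
        refine setIntegral_mono_on ?_ (integrable_const _) measurableSet_Ioc hw2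
        exact (integrable_sq_of_abs_le (ν := (volume.restrict (Set.Ioc (0 : ℝ) 1)).prod μ) hwm
            fun z => hwb _ _).integral_prod_left
    _ < ε := by simp; linarith

/-- Coercivity speaks only of the domain of the generator, which need not contain `f` itself, for
instance a centred indicator. Time integration supplies elements of the domain to test with. -/
lemma hasGenerator_potential (P : MarkovFamily E Ω) {μ : Measure E}
    [IsProbabilityMeasure μ] (hinv : P.IsInvariant μ) {f : E → ℝ} (hf : Measurable f) {M : ℝ}
    (hM : ∀ x, |f x| ≤ M) (t : ℝ≥0) :
    P.HasGenerator μ (P.potential f t) (fun x => P.semigroup t f x - f x) := by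
  have hgm := P.measurable_potential hf t.coe_nonneg
  have hgb := P.abs_potential_le hM t.coe_nonneg
  have hLm : Measurable fun x => P.semigroup t f x - f x :=
    (P.measurable_semigroup_apply t hf).sub hf
  have hLb : ∀ x, |P.semigroup t f x - f x| ≤ 2 * M := fun x =>
    abs_sub_le_two_mul (P.abs_semigroup_le t hM x) (hM x)
  refine ⟨MemLp.of_bound hgm.aestronglyMeasurable _ (ae_of_all _ hgb),
    MemLp.of_bound hLm.aestronglyMeasurable _ (ae_of_all _ hLb), ?_⟩
  have h := P.tendsto_integral_sq_generator hinv hf hM t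
  have h2 := ENNReal.tendsto_ofReal (h.rpow_const (p := 2⁻¹) (Or.inr (by norm_num)))
  rw [Real.zero_rpow (by norm_num), ENNReal.ofReal_zero] at h2
  refine h2.congr' ?_
  filter_upwards [self_mem_nhdsWithin] with s hs
  have hm : MemLp (fun x => (P.semigroup s (P.potential f t) x - P.potential f t x) / (s : ℝ)
      - (P.semigroup t f x - f x)) 2 μ := by
    refine MemLp.of_bound ((((P.measurable_semigroup_apply s hgm).sub hgm).div_const _).sub
      hLm).aestronglyMeasurable (2 * (M * t) / s + 2 * M) (ae_of_all _ fun x => ?_)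
    refine (abs_sub _ _).trans (add_le_add ?_ (hLb x))
    rw [abs_div, NNReal.abs_eq]
    exact div_le_div_of_nonneg_right
      (abs_sub_le_two_mul (P.abs_semigroup_le s hgb x) (hgb x)) s.coe_nonneg
  rw [hm.eLpNorm_eq_integral_rpow_norm two_ne_zero ENNReal.ofNat_ne_top]
  simp

/-- Coercivity bounds the truncated potentials of bounded centred functions. -/
lemma integral_mul_potential_le (P : MarkovFamily E Ω) {μ : Measure E}
    [IsProbabilityMeasure μ] (hinv : P.IsInvariant μ) {lam : ℝ} (hlam : 0 < lam)
    (hcoer : ∀ f g : E → ℝ, P.HasGenerator μ f g → ∫ x, f x ∂μ = 0 →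
      lam * ∫ x, f x ^ 2 ∂μ ≤ ∫ x, (-g x) * f x ∂μ)
    {f : E → ℝ} (hf : Measurable f) {M : ℝ}
    (hM : ∀ x, |f x| ≤ M) (h0 : ∫ x, f x ∂μ = 0) {t : ℝ} (ht : 0 ≤ t) :
    ∫ x, f x * P.potential f t x ∂μ ≤ 2 / lam * ∫ x, f x ^ 2 ∂μ := by
  lift t to ℝ≥0 using ht
  have hgm := P.measurable_potential hf t.coe_nonneg
  have hgb := P.abs_potential_le hM t.coe_nonneg
  have hPm := P.measurable_semigroup_apply t hf
  have hPb := P.abs_semigroup_le t hM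
  have hg0 : ∫ x, P.potential f t x ∂μ = 0 := by
    rw [P.integral_potential hf hM t.coe_nonneg]
    simp_rw [P.integral_semigroup hinv _ hf hM, h0]
    simp
  have hc := hcoer _ _ (P.hasGenerator_potential hinv hf hM t) hg0
  have ig2 : Integrable (fun x => P.potential f t x ^ 2) μ := integrable_sq_of_abs_le hgm hgb
  have if2 : Integrable (fun x => f x ^ 2) μ := integrable_sq_of_abs_le hf hM
  have iP2 : Integrable (fun x => P.semigroup t f x ^ 2) μ := integrable_sq_of_abs_le hPm hPb
  have imul : ∀ {u v : E → ℝ} {A B : ℝ}, Measurable u → (∀ x, |u x| ≤ A) → Measurable v →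
      (∀ x, |v x| ≤ B) → Integrable (fun x => u x * v x) μ := fun hu hA hv hB =>
    (integrable_of_abs_le hu hA).mul_bdd hv.aestronglyMeasurable (ae_of_all _ hB)
  have hP := P.integral_sq_semigroup_le hinv t hf hM
  have i3 : Integrable (fun x => (1 / lam) * f x ^ 2 + (lam / 2) * P.potential f t x ^ 2) μ :=
    (if2.const_mul _).add (ig2.const_mul _)
  -- Young's inequality leaves `(λ/2)‖g‖²` to be absorbed by the `λ‖g‖²` of coercivity. Together
  -- with contraction this gives `‖g‖² ≤ (4/λ²)‖f‖²`.
  have h1 : ∫ x, (-(P.semigroup t f x - f x)) * P.potential f t x ∂μ ≤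
      ∫ x, ((1 / lam) * P.semigroup t f x ^ 2 + ((1 / lam) * f x ^ 2
        + (lam / 2) * P.potential f t x ^ 2)) ∂μ := by
    refine integral_mono (imul (hPm.sub hf).neg (A := 2 * M)
      (fun x => by rw [abs_neg]; exact abs_sub_le_two_mul (hPb x) (hM x)) hgm hgb)
      ((iP2.const_mul _).add i3) fun x => ?_
    simp only
    set a := P.semigroup t f x
    set b := f x
    set g := P.potential f t x
    have e : (1 / lam) * a ^ 2 + ((1 / lam) * b ^ 2 + (lam / 2) * g ^ 2) - (-(a - b)) * g =
        (1 / (2 * lam)) * ((a + b) ^ 2 + (a - b + lam * g) ^ 2) := by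
      field_simp; ring
    have : 0 ≤ (1 / (2 * lam)) * ((a + b) ^ 2 + (a - b + lam * g) ^ 2) := by positivity
    linarith
  rw [integral_add (iP2.const_mul _) i3,
    integral_add (if2.const_mul _) (ig2.const_mul _), integral_const_mul, integral_const_mul,
    integral_const_mul] at h1
  -- With the weight `λ/4`, the bound on `‖g‖²` makes both terms at most `‖f‖²/λ`.
  have h2 : ∫ x, f x * P.potential f t x ∂μ ≤
      ∫ x, ((1 / lam) * f x ^ 2 + (lam / 4) * P.potential f t x ^ 2) ∂μ := by
    refine integral_mono (imul hf hM hgm hgb)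
      ((if2.const_mul _).add (ig2.const_mul _)) fun x => ?_
    simp only
    set b := f x
    set g := P.potential f t x
    have e : (1 / lam) * b ^ 2 + (lam / 4) * g ^ 2 - b * g =
        (1 / lam) * (b - lam / 2 * g) ^ 2 := by
      field_simp; ring
    have : 0 ≤ (1 / lam) * (b - lam / 2 * g) ^ 2 := by positivity
    linarith
  rw [integral_add (if2.const_mul _) (ig2.const_mul _), integral_const_mul,
    integral_const_mul] at h2
  have h3 : (1 / lam) * ∫ x, P.semigroup t f x ^ 2 ∂μ ≤ (1 / lam) * ∫ x, f x ^ 2 ∂μ :=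
    mul_le_mul_of_nonneg_left hP (by positivity)
  have e : 2 / lam = 2 * (1 / lam) := by ring
  rw [e]
  linarith

end MarkovFamily

/-! ### Variance of occupation times and deviations of the empirical measure. -/

lemma abs_integral_le_of_abs_le {α : Type*} [MeasurableSpace α] {ν : Measure α}
    [IsFiniteMeasure ν] {u : α → ℝ} {M : ℝ} (hM : ∀ x, |u x| ≤ M) :
    |∫ x, u x ∂ν| ≤ M * ν.real Set.univ :=
  norm_integral_le_of_norm_le_const (f := u) (μ := ν) (ae_of_all _ hM)

namespace MarkovFamily

variable {E Ω : Type*} [MeasurableSpace E] [MeasurableSpace Ω]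

lemma integral_mul_X (P : MarkovFamily E Ω) {μ : Measure E} [IsProbabilityMeasure μ]
    (hinv : P.IsInvariant μ) {f : E → ℝ} (hf : Measurable f) {M : ℝ} (hM : ∀ x, |f x| ≤ M)
    (s r : ℝ≥0) :
    ∫ ω, f (P.X s ω) * f (P.X (s + r) ω) ∂(P.lawFrom μ) =
      ∫ x, f x * P.semigroup r f x ∂μ := by
  have hm : Measurable fun z : E × E => f z.1 * f z.2 :=
    (hf.comp measurable_fst).mul (hf.comp measurable_snd)
  have h := integral_map (μ := P.lawFrom μ)
    ((P.measurable_X_apply s).prodMk (P.measurable_X_apply (s + r))).aemeasurable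
    (f := fun z : E × E => f z.1 * f z.2) hm.aestronglyMeasurable
  rw [← h, P.map_pair_lawFrom hinv, Measure.integral_compProd]
  · simp_rw [integral_const_mul, P.semigroup_eq r hf]
  · refine integrable_of_abs_le (M := M * M) hm fun z => ?_
    rw [abs_mul]
    exact mul_le_mul (hM _) (hM _) (abs_nonneg _) ((abs_nonneg _).trans (hM z.1))

/-- The stationary variance of the occupation integral of a bounded centred function grows at
most linearly in time. -/
lemma integral_sq_occupation_le (P : MarkovFamily E Ω) {μ : Measure E}
    [IsProbabilityMeasure μ] (hinv : P.IsInvariant μ) {lam : ℝ} (hlam : 0 < lam)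
    (hcoer : ∀ f g : E → ℝ, P.HasGenerator μ f g → ∫ x, f x ∂μ = 0 →
      lam * ∫ x, f x ^ 2 ∂μ ≤ ∫ x, (-g x) * f x ∂μ)
    {f : E → ℝ} (hf : Measurable f) {M : ℝ}
    (hM : ∀ x, |f x| ≤ M) (h0 : ∫ x, f x ∂μ = 0) {T : ℝ} (hT : 0 ≤ T) :
    ∫ ω, (∫ t in Set.Ioc 0 T, f (P.X t.toNNReal ω)) ^ 2 ∂(P.lawFrom μ) ≤
      4 / lam * T * ∫ x, f x ^ 2 ∂μ := by
  have : IsProbabilityMeasure (P.lawFrom μ) := P.isProbabilityMeasure_lawFrom μ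
  let ν : Measure ℝ := volume.restrict (Set.Ioc 0 T)
  let φ : ℝ → ℝ := fun r => ∫ x, f x * P.semigroup r.toNNReal f x ∂μ
  have hbb : ∀ {a b : ℝ}, |a| ≤ M → |b| ≤ M → |a * b| ≤ M * M := fun ha hb => by
    rw [abs_mul]; exact mul_le_mul ha hb (abs_nonneg _) ((abs_nonneg _).trans ha)
  have hφm : Measurable φ := by
    have : StronglyMeasurable fun z : ℝ × E => f z.2 * P.semigroup z.1.toNNReal f z.2 :=
      ((hf.comp measurable_snd).mul (P.measurable_semigroup hf)).stronglyMeasurable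
    exact (this.integral_prod_right' (ν := μ)).measurable
  have hφb : ∀ r, |φ r| ≤ M * M := fun r => by
    refine (abs_integral_le_of_abs_le fun x => hbb (hM x) (P.abs_semigroup_le _ hM x)).trans ?_
    simp
  have hcov : ∀ s t : ℝ, 0 ≤ s → s ≤ t →
      ∫ ω, f (P.X s.toNNReal ω) * f (P.X t.toNNReal ω) ∂(P.lawFrom μ) = φ (t - s) := by
    intro s t hs hst
    have e : t.toNNReal = s.toNNReal + (t - s).toNNReal := by
      rw [← Real.toNNReal_add hs (sub_nonneg.2 hst)]; simp
    rw [e]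
    exact P.integral_mul_X hinv hf hM _ _
  have hcov' : ∀ s t : ℝ, 0 ≤ t → t ≤ s →
      ∫ ω, f (P.X s.toNNReal ω) * f (P.X t.toNNReal ω) ∂(P.lawFrom μ) = φ (s - t) := by
    intro s t hs hst
    rw [← hcov t s hs hst]
    simp_rw [mul_comm]
  have hφint : ∀ t : ℝ, 0 ≤ t → ∫ r in (0 : ℝ)..t, φ r ≤ 2 / lam * ∫ x, f x ^ 2 ∂μ :=
    fun t ht => by
      rw [← P.integral_mul_potential hf hM hf hM ht μ]
      exact P.integral_mul_potential_le hinv hlam hcoer hf hM h0 ht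
  have hum : Measurable fun z : Ω × ℝ => f (P.X z.2.toNNReal z.1) := by
    have h1 : Measurable fun z : Ω × ℝ => (z.2.toNNReal, z.1) := by fun_prop
    exact (hf.comp P.measurable_X).comp h1
  have hIm : Measurable fun ω => ∫ t, f (P.X t.toNNReal ω) ∂ν :=
    (hum.stronglyMeasurable.integral_prod_right' (ν := ν)).measurable
  have hIb : ∀ ω, |∫ t, f (P.X t.toNNReal ω) ∂ν| ≤ M * T := fun ω => by
    refine (abs_integral_le_of_abs_le fun t => hM _).trans ?_
    simp [ν, hT]
  have e1 : ∀ ω, (∫ t, f (P.X t.toNNReal ω) ∂ν) ^ 2 =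
      ∫ s, f (P.X s.toNNReal ω) * (∫ t, f (P.X t.toNNReal ω) ∂ν) ∂ν := fun ω => by
    rw [integral_mul_const, sq]
  change ∫ ω, (∫ t, f (P.X t.toNNReal ω) ∂ν) ^ 2 ∂(P.lawFrom μ) ≤ _
  simp_rw [e1]
  rw [integral_integral_swap
    (f := fun ω (s : ℝ) => f (P.X s.toNNReal ω) * (∫ t, f (P.X t.toNNReal ω) ∂ν))]
  swap
  · refine integrable_of_abs_le (M := M * (M * T)) (hum.mul (hIm.comp measurable_fst)) fun z => ?_
    simp only [Function.uncurry]
    rw [abs_mul]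
    exact mul_le_mul (hM _) (hIb _) (abs_nonneg _) ((abs_nonneg _).trans (hM (P.X 0 z.1)))
  -- For fixed `s` the covariance depends only on `|s - t|`. Splitting the `t`-integral at `s` gives
  -- the integrals of `φ` over `[0, s]` and `[0, T - s]`, each at most `(2/λ)‖f‖²`.
  have e2 : ∀ s ∈ Set.Ioc 0 T,
      ∫ ω, f (P.X s.toNNReal ω) * (∫ t, f (P.X t.toNNReal ω) ∂ν) ∂(P.lawFrom μ) ≤
        4 / lam * ∫ x, f x ^ 2 ∂μ := by
    intro s hs
    have e0 : ∀ ω, f (P.X s.toNNReal ω) * (∫ t, f (P.X t.toNNReal ω) ∂ν) =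
        ∫ t, f (P.X s.toNNReal ω) * f (P.X t.toNNReal ω) ∂ν := fun ω =>
      (integral_const_mul _ _).symm
    simp_rw [e0]
    rw [integral_integral_swap
      (f := fun ω (t : ℝ) => f (P.X s.toNNReal ω) * f (P.X t.toNNReal ω))]
    swap
    · exact integrable_of_abs_le (M := M * M) (((hf.comp (P.measurable_X_apply _)).comp
        measurable_fst).mul hum) fun z => hbb (hM _) (hM _)
    have e3 : ∫ t, (∫ ω, f (P.X s.toNNReal ω) * f (P.X t.toNNReal ω) ∂(P.lawFrom μ)) ∂ν =
        ∫ t in (0 : ℝ)..T, φ |s - t| := by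
      rw [intervalIntegral.integral_of_le hT]
      refine setIntegral_congr_fun measurableSet_Ioc fun t ht => ?_
      rcases le_total s t with h | h
      · rw [hcov s t hs.1.le h, abs_sub_comm, abs_of_nonneg (sub_nonneg.2 h)]
      · rw [hcov' s t ht.1.le h, abs_of_nonneg (sub_nonneg.2 h)]
    have hi : ∀ a b, IntervalIntegrable (fun t => φ |s - t|) volume a b :=
      intervalIntegrable_of_abs_le (hφm.comp (by fun_prop)) fun t => hφb _
    rw [e3, ← intervalIntegral.integral_add_adjacent_intervals (hi 0 s) (hi s T)]
    have e4 : ∫ t in (0 : ℝ)..s, φ |s - t| = ∫ r in (0 : ℝ)..s, φ r := by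
      rw [intervalIntegral.integral_congr (g := fun t => φ (s - t)),
        intervalIntegral.integral_comp_sub_left (fun t => φ t), sub_self, sub_zero]
      intro t ht
      rw [Set.uIcc_of_le hs.1.le] at ht
      simp only [abs_of_nonneg (sub_nonneg.2 ht.2)]
    have e5 : ∫ t in s..T, φ |s - t| = ∫ r in (0 : ℝ)..(T - s), φ r := by
      rw [intervalIntegral.integral_congr (g := fun t => φ (t - s)),
        intervalIntegral.integral_comp_sub_right (fun t => φ t), sub_self]
      intro t ht
      rw [Set.uIcc_of_le hs.2] at ht
      simp only
      rw [abs_sub_comm, abs_of_nonneg (sub_nonneg.2 ht.1)]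
    rw [e4, e5]
    have := hφint s hs.1.le
    have := hφint (T - s) (sub_nonneg.2 hs.2)
    have e : 4 / lam = 2 * (2 / lam) := by ring
    rw [e]; linarith
  calc _ ≤ ∫ s in Set.Ioc 0 T, 4 / lam * ∫ x, f x ^ 2 ∂μ := by
        refine setIntegral_mono_on ?_ (integrable_const _) measurableSet_Ioc e2
        refine (Integrable.integral_prod_left (μ := ν) (ν := P.lawFrom μ) (f := fun z : ℝ × Ω =>
          f (P.X z.1.toNNReal z.2) * (∫ t, f (P.X t.toNNReal z.2) ∂ν)) ?_)
        refine integrable_of_abs_le (M := M * (M * T))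
          ((hum.comp measurable_swap).mul (hIm.comp measurable_snd)) fun z => ?_
        rw [abs_mul]
        exact mul_le_mul (hM _) (hIb _) (abs_nonneg _) ((abs_nonneg _).trans (hM (P.X 0 z.2)))
    _ = _ := by simp [hT]; ring

lemma empirical_apply (P : MarkovFamily E Ω) (T : ℝ) (ω : Ω) {A : Set E} (hA : MeasurableSet A) :
    P.empirical T ω A = ENNReal.ofReal (1 / T) *
      ∫⁻ t in Set.Ioc 0 T, A.indicator 1 (P.X t.toNNReal ω) := by
  rw [empirical, Measure.smul_apply, smul_eq_mul,
    ← lintegral_map (measurable_one.indicator hA) (P.measurable_path ω),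
    lintegral_indicator_one hA]

lemma isProbabilityMeasure_empirical (P : MarkovFamily E Ω) {T : ℝ} (hT : 0 < T) (ω : Ω) :
    IsProbabilityMeasure (P.empirical T ω) := by
  constructor
  rw [P.empirical_apply T ω .univ]
  simp only [Set.indicator_univ, Pi.one_apply, lintegral_const, one_mul,
    Measure.restrict_apply MeasurableSet.univ, Set.univ_inter, Real.volume_Ioc, sub_zero]
  rw [← ENNReal.ofReal_mul (by positivity), one_div_mul_cancel hT.ne', ENNReal.ofReal_one]

lemma measurable_empirical_apply (P : MarkovFamily E Ω) (T : ℝ) {A : Set E}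
    (hA : MeasurableSet A) : Measurable fun ω => P.empirical T ω A := by
  simp_rw [P.empirical_apply T _ hA]
  refine Measurable.const_mul ?_ _
  have h1 : Measurable fun z : Ω × ℝ => (z.2.toNNReal, z.1) := by fun_prop
  exact (((measurable_one (α := ℝ≥0∞).indicator hA).comp P.measurable_X).comp h1).lintegral_prod_right'

/-- The mean of the empirical measure is the invariant measure. -/
lemma lintegral_empirical (P : MarkovFamily E Ω) {μ : Measure E} [IsProbabilityMeasure μ]
    (hinv : P.IsInvariant μ) {T : ℝ} (hT : 0 < T) {A : Set E} (hA : MeasurableSet A) :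
    ∫⁻ ω, P.empirical T ω A ∂(P.lawFrom μ) = μ A := by
  have : IsProbabilityMeasure (P.lawFrom μ) := P.isProbabilityMeasure_lawFrom μ
  have h1 : Measurable fun z : Ω × ℝ => (z.2.toNNReal, z.1) := by fun_prop
  have h2 : Measurable fun z : Ω × ℝ => A.indicator (1 : E → ℝ≥0∞) (P.X z.2.toNNReal z.1) :=
    ((measurable_one.indicator hA).comp P.measurable_X).comp h1
  simp_rw [P.empirical_apply T _ hA]
  rw [lintegral_const_mul _ h2.lintegral_prod_right',
    lintegral_lintegral_swap h2.aemeasurable]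
  have h3 : ∀ t : ℝ, ∫⁻ ω, A.indicator (1 : E → ℝ≥0∞) (P.X t.toNNReal ω) ∂(P.lawFrom μ) = μ A := by
    intro t
    rw [← lintegral_map (measurable_one.indicator hA) (P.measurable_X_apply _),
      P.map_X_lawFrom hinv, lintegral_indicator_one hA]
  simp_rw [h3]
  rw [lintegral_const, Measure.restrict_apply .univ, Set.univ_inter, Real.volume_Ioc, sub_zero,
    mul_comm, mul_assoc, ← ENNReal.ofReal_mul hT.le, mul_one_div_cancel hT.ne', ENNReal.ofReal_one,
    mul_one]

/-- Mean absolute deviation of the occupation frequency of a set. -/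
lemma lintegral_empirical_sub_le (P : MarkovFamily E Ω) {μ : Measure E}
    [IsProbabilityMeasure μ] (hinv : P.IsInvariant μ) {lam : ℝ} (hlam : 0 < lam)
    (hcoer : ∀ f g : E → ℝ, P.HasGenerator μ f g → ∫ x, f x ∂μ = 0 →
      lam * ∫ x, f x ^ 2 ∂μ ≤ ∫ x, (-g x) * f x ∂μ)
    {T : ℝ} (hT : 0 < T) {A : Set E} (hA : MeasurableSet A) :
    ∫⁻ ω, ((P.empirical T ω A - μ A) + (μ A - P.empirical T ω A)) ∂(P.lawFrom μ) ≤
      ENNReal.ofReal √(4 / lam * μ.real A / T) := by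
  have : IsProbabilityMeasure (P.lawFrom μ) := P.isProbabilityMeasure_lawFrom μ
  have hemp := fun ω => P.isProbabilityMeasure_empirical hT ω
  let v : Ω → ℝ := fun ω => (P.empirical T ω).real A - μ.real A
  have hvm : Measurable v := ((P.measurable_empirical_apply T hA).ennreal_toReal).sub_const _
  have hvb : ∀ ω, |v ω| ≤ 1 := fun ω => abs_sub_le_of_le_of_le measureReal_nonneg
    measureReal_le_one measureReal_nonneg measureReal_le_one |>.trans (by simp)
  -- Subtraction is truncated, so at most one summand is nonzero.
  have e1 : ∀ ω, (P.empirical T ω A - μ A) + (μ A - P.empirical T ω A) = ENNReal.ofReal |v ω| := by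
    intro ω
    rw [← ofReal_measureReal (μ := μ), ← ofReal_measureReal (μ := P.empirical T ω),
      ← ENNReal.ofReal_sub _ measureReal_nonneg, ← ENNReal.ofReal_sub _ measureReal_nonneg]
    simp only [v]
    rcases le_total ((P.empirical T ω).real A) (μ.real A) with h | h
    · rw [ENNReal.ofReal_of_nonpos (sub_nonpos.2 h), zero_add, abs_sub_comm,
        abs_of_nonneg (sub_nonneg.2 h)]
    · rw [ENNReal.ofReal_of_nonpos (sub_nonpos.2 h), add_zero, abs_of_nonneg (sub_nonneg.2 h)]
  simp_rw [e1]
  rw [← ofReal_integral_eq_lintegral_ofReal (integrable_of_abs_le hvm hvb).abs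
    (ae_of_all _ fun ω => abs_nonneg _)]
  refine ENNReal.ofReal_le_ofReal (Real.le_sqrt_of_sq_le ?_)
  refine (sq_integral_le_integral_sq (M := 1) hvm.abs fun ω => by rw [abs_abs]; exact hvb ω).trans ?_
  simp_rw [sq_abs]
  let f : E → ℝ := fun x => A.indicator 1 x - μ.real A
  have hfm : Measurable f := (measurable_one.indicator hA).sub_const _
  have hind : ∀ x, A.indicator (1 : E → ℝ) x = 0 ∨ A.indicator (1 : E → ℝ) x = 1 := fun x =>
    Set.indicator_eq_zero_or_self _ _ _
  have hfb : ∀ x, |f x| ≤ 1 := fun x => by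
    have h1 := measureReal_nonneg (μ := μ) (s := A)
    have h2 := measureReal_le_one (μ := μ) (s := A)
    rw [abs_le]
    rcases hind x with h | h <;> simp only [f, h] <;> constructor <;> linarith
  have hi1 : ∀ {ν : Measure E} [IsFiniteMeasure ν], Integrable (A.indicator (1 : E → ℝ)) ν :=
    fun {ν} _ => (integrable_const (1 : ℝ)).indicator hA
  have hf0 : ∫ x, f x ∂μ = 0 := by
    simp only [f]
    rw [integral_sub hi1 (integrable_const _), integral_indicator_one hA]
    simp
  -- The integral is the Bernoulli variance `μ(A)(1 - μ(A))`. Keeping the factor `μ(A)` is what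
  -- later makes the mass of each ring count.
  have hf2 : ∫ x, f x ^ 2 ∂μ ≤ μ.real A := by
    have e : ∀ x, f x ^ 2 = (1 - 2 * μ.real A) * A.indicator 1 x + μ.real A ^ 2 := fun x => by
      rcases hind x with h | h <;> simp only [f, h] <;> ring
    simp_rw [e]
    rw [integral_add (hi1.const_mul _) (integrable_const _), integral_const_mul,
      integral_indicator_one hA]
    simp
    nlinarith [measureReal_nonneg (μ := μ) (s := A)]
  have hv : ∀ ω, v ω = 1 / T * ∫ t in Set.Ioc 0 T, f (P.X t.toNNReal ω) := by
    intro ω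
    have hpi : Integrable (fun t : ℝ => A.indicator (1 : E → ℝ) (P.X t.toNNReal ω))
        (volume.restrict (Set.Ioc 0 T)) :=
      integrable_of_abs_le (M := 1) ((measurable_one.indicator hA).comp (P.measurable_path ω))
        fun t => by rcases hind (P.X t.toNNReal ω) with h | h <;> simp [h]
    have e2 : (P.empirical T ω).real A =
        1 / T * ∫ t in Set.Ioc 0 T, A.indicator (1 : E → ℝ) (P.X t.toNNReal ω) := by
      rw [← integral_indicator_one hA, empirical, integral_smul_measure,
        integral_map (P.measurable_path ω).aemeasurable
          (measurable_one.indicator hA).aestronglyMeasurable,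
        ENNReal.toReal_ofReal (by positivity), smul_eq_mul]
    simp only [v, f]
    rw [integral_sub hpi (integrable_const _), e2, mul_sub]
    simp [hT.le]
    field_simp
  simp_rw [hv, mul_pow]
  rw [integral_const_mul]
  have h := P.integral_sq_occupation_le hinv hlam hcoer hfm hfb hf0 hT.le
  calc _ ≤ (1 / T) ^ 2 * (4 / lam * T * μ.real A) := by
        refine mul_le_mul_of_nonneg_left (h.trans ?_) (by positivity)
        exact mul_le_mul_of_nonneg_left hf2 (by positivity)
    _ = _ := by field_simp

end MarkovFamily

/-! ### Multiscale couplings along countable partitions. -/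

lemma lintegral_comp_countable {E ι : Type*} [MeasurableSpace E] [Countable ι] [MeasurableSpace ι]
    [MeasurableSingletonClass ι] {c : E → ι} (hc : Measurable c) (D : ι → ℝ≥0∞) (σ : Measure E) :
    ∫⁻ x, D (c x) ∂σ = ∑' i, D i * σ (c ⁻¹' {i}) := by
  rw [← lintegral_map (measurable_of_countable D) hc, lintegral_countable']
  simp_rw [Measure.map_apply hc (measurableSet_singleton _)]

lemma one_sub_min_div_mul {a b : ℝ≥0∞} (ha : a ≠ ∞) : (1 - min a b / a) * a = a - b := by
  rcases eq_or_ne a 0 with rfl | h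
  · simp
  · rw [ENNReal.sub_mul fun _ _ => ha, one_mul, ENNReal.div_mul_cancel h ha, tsub_min]

/-- Two finite measures can be matched inside the cells of a countable partition up to the excess
mass of each cell. -/
lemma exists_cellwise_coupling {E ι : Type*} [MeasurableSpace E] [Countable ι] [MeasurableSpace ι]
    [MeasurableSingletonClass ι] (ν₀ ν₁ : Measure E) [IsFiniteMeasure ν₀] [IsFiniteMeasure ν₁]
    {c : E → ι} (hc : Measurable c) :
    ∃ (π : Measure (E × E)) (σ₀ σ₁ : Measure E), π.map Prod.fst + σ₀ = ν₀ ∧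
      π.map Prod.snd + σ₁ = ν₁ ∧ (∀ᵐ z ∂π, c z.1 = c z.2) ∧
      ∀ i, σ₀ (c ⁻¹' {i}) = ν₀ (c ⁻¹' {i}) - ν₁ (c ⁻¹' {i}) ∧
        σ₁ (c ⁻¹' {i}) = ν₁ (c ⁻¹' {i}) - ν₀ (c ⁻¹' {i}) := by
  classical
  let a : ι → ℝ≥0∞ := fun i => ν₀ (c ⁻¹' {i})
  let b : ι → ℝ≥0∞ := fun i => ν₁ (c ⁻¹' {i})
  let m : ι → ℝ≥0∞ := fun i => min (a i) (b i)
  have ha : ∀ i, a i ≠ ∞ := fun i => measure_ne_top _ _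
  have hb : ∀ i, b i ≠ ∞ := fun i => measure_ne_top _ _
  have hcs : ∀ i, MeasurableSet (c ⁻¹' {i}) := fun i => hc (measurableSet_singleton i)
  -- Relative to `ν₀ ⊗ ν₁`, this density puts mass `min (a i) (b i)` on the square of cell `i`. If
  -- the cell is null for either measure, the convention `0 / 0 = 0` gives density zero.
  let k : ι → ℝ≥0∞ := fun i => m i / (a i * b i)
  let D : E × E → ℝ≥0∞ := fun z => if c z.1 = c z.2 then k (c z.1) else 0
  have hcomp : ∀ g : ι → ℝ≥0∞, Measurable fun x => g (c x) := fun g =>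
    (measurable_of_countable g).comp hc
  have hD : Measurable D :=
    (measurable_of_countable fun w : ι × ι => if w.1 = w.2 then k w.1 else 0).comp
      ((hc.comp measurable_fst).prodMk (hc.comp measurable_snd))
  have hk0 : ∀ i, k i * b i = m i / a i := fun i => by
    rcases eq_or_ne (b i) 0 with h | h
    · simp [k, m, h]
    · rcases eq_or_ne (a i) 0 with h' | h'
      · simp [k, m, h']
      · simp only [k]
        rw [div_eq_mul_inv, ENNReal.mul_inv (Or.inl h') (Or.inl (ha i)), mul_assoc, mul_assoc,
          ENNReal.inv_mul_cancel h (hb i), mul_one, div_eq_mul_inv]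
  have hk1 : ∀ i, k i * a i = m i / b i := fun i => by
    rcases eq_or_ne (b i) 0 with h | h
    · simp [k, m, h]
    · rcases eq_or_ne (a i) 0 with h' | h'
      · simp [k, m, h']
      · simp only [k]
        rw [div_eq_mul_inv, mul_comm (a i), ENNReal.mul_inv (Or.inl h) (Or.inl (hb i)), mul_assoc,
          mul_assoc, ENNReal.inv_mul_cancel h' (ha i), mul_one, div_eq_mul_inv]
  have hma : ∀ i, m i / a i ≤ 1 := fun i => ENNReal.div_le_of_le_mul (by simp [m])
  have hmb : ∀ i, m i / b i ≤ 1 := fun i => ENNReal.div_le_of_le_mul (by simp [m])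
  have hdx : ∀ x, ∫⁻ y, D (x, y) ∂ν₁ = m (c x) / a (c x) := fun x => by
    rw [← hk0]
    have : ∀ y, D (x, y) = (c ⁻¹' {c x}).indicator (fun _ => k (c x)) y := fun y => by
      by_cases h : c x = c y
      · simp [D, h]
      · simp [D, h, Ne.symm h]
    simp_rw [this]
    rw [lintegral_indicator_const (hcs _)]
  have hdy : ∀ y, ∫⁻ x, D (x, y) ∂ν₀ = m (c y) / b (c y) := fun y => by
    rw [← hk1]
    have : ∀ x, D (x, y) = (c ⁻¹' {c y}).indicator (fun _ => k (c y)) x := fun x => by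
      by_cases h : c x = c y
      · simp [D, h]
      · simp [D, h]
    simp_rw [this]
    rw [lintegral_indicator_const (hcs _)]
  have hsum : ∀ (ν : Measure E) (g : ι → ℝ≥0∞), (∀ i, g i ≤ 1) →
      ν.withDensity (fun x => g (c x)) + ν.withDensity (fun x => 1 - g (c x)) = ν := by
    intro ν g hg
    rw [← withDensity_add_left (hcomp g)]
    have : ((fun x => g (c x)) + fun x => 1 - g (c x)) = 1 := by
      ext x
      simp [add_tsub_cancel_of_le (hg (c x))]
    rw [this, withDensity_one]
  refine ⟨(ν₀.prod ν₁).withDensity D, ν₀.withDensity (fun x => 1 - m (c x) / a (c x)),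
    ν₁.withDensity (fun x => 1 - m (c x) / b (c x)), ?_, ?_, ?_, fun i => ⟨?_, ?_⟩⟩
  · convert hsum ν₀ (fun i => m i / a i) hma using 2
    ext S hS
    rw [Measure.map_apply measurable_fst hS, withDensity_apply _ (measurable_fst hS),
      withDensity_apply _ hS, ← Set.prod_univ, ← Measure.prod_restrict, Measure.restrict_univ,
      lintegral_prod _ hD.aemeasurable]
    simp_rw [hdx]
  · convert hsum ν₁ (fun i => m i / b i) hmb using 2
    ext S hS
    rw [Measure.map_apply measurable_snd hS, withDensity_apply _ (measurable_snd hS),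
      withDensity_apply _ hS, ← Set.univ_prod, ← Measure.prod_restrict, Measure.restrict_univ,
      lintegral_prod_symm _ hD.aemeasurable]
    simp_rw [hdy]
  · rw [ae_withDensity_iff hD]
    refine ae_of_all _ fun z hz => ?_
    by_contra h
    exact hz (if_neg h)
  · rw [withDensity_apply _ (hcs i), setLIntegral_congr_fun (hcs i)
      (g := fun _ => 1 - m i / a i) (fun x hx => by rw [Set.mem_preimage.1 hx]),
      setLIntegral_const]
    exact one_sub_min_div_mul (ha i)
  · rw [withDensity_apply _ (hcs i), setLIntegral_congr_fun (hcs i)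
      (g := fun _ => 1 - m i / b i) (fun x hx => by rw [Set.mem_preimage.1 hx]),
      setLIntegral_const]
    simp only [m, min_comm (a i)]
    exact one_sub_min_div_mul (hb i)

/-- A coupling of parts of `ν₀` and `ν₁` inside the cells of `c`, with cost at most `B`, that leaves
over exactly the excess mass of each cell. -/
def HasPartialCoupling {E ι : Type*} [MeasurableSpace E] (cost : E × E → ℝ≥0∞)
    (ν₀ ν₁ : Measure E) (c : E → ι) (B : ℝ≥0∞) : Prop :=
  ∃ (π : Measure (E × E)) (σ₀ σ₁ : Measure E), π.map Prod.fst + σ₀ = ν₀ ∧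
    π.map Prod.snd + σ₁ = ν₁ ∧ (∀ᵐ z ∂π, c z.1 = c z.2) ∧
    (∀ i, σ₀ (c ⁻¹' {i}) = ν₀ (c ⁻¹' {i}) - ν₁ (c ⁻¹' {i}) ∧
      σ₁ (c ⁻¹' {i}) = ν₁ (c ⁻¹' {i}) - ν₀ (c ⁻¹' {i})) ∧ ∫⁻ z, cost z ∂π ≤ B

section
variable {E ι : Type*} [MeasurableSpace E] [Countable ι] [MeasurableSpace ι]
  [MeasurableSingletonClass ι] {cost : E × E → ℝ≥0∞} {ν₀ ν₁ : Measure E}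

/-- The starting point at the finest scale: the second marginal of the matched part is dominated by
`ν₁`, so the mass moved in a cell is at most its `ν₁`-mass. -/
lemma hasPartialCoupling_of_cost_le [IsFiniteMeasure ν₀] [IsFiniteMeasure ν₁] {c : E → ι}
    (hc : Measurable c) (D : ι → ℝ≥0∞) (hD : ∀ x y, c x = c y → cost (x, y) ≤ D (c y)) :
    HasPartialCoupling cost ν₀ ν₁ c (∑' i, D i * ν₁ (c ⁻¹' {i})) := by
  obtain ⟨π, σ₀, σ₁, h0, h1, hae, hσ⟩ := exists_cellwise_coupling ν₀ ν₁ hc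
  refine ⟨π, σ₀, σ₁, h0, h1, hae, hσ, ?_⟩
  calc ∫⁻ z, cost z ∂π ≤ ∫⁻ z, D (c z.2) ∂π := lintegral_mono_ae (hae.mono fun z hz => hD _ _ hz)
    _ = ∫⁻ y, D (c y) ∂(π.map Prod.snd) :=
      (lintegral_map ((measurable_of_countable D).comp hc) measurable_snd).symm
    _ ≤ ∫⁻ y, D (c y) ∂ν₁ := lintegral_mono' (by rw [← h1]; exact Measure.le_add_right le_rfl) le_rfl
    _ = _ := lintegral_comp_countable hc D ν₁

/-- Only the leftovers `σ₀`, `σ₁` are matched anew, so the extra cost involves only the excess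
masses of the finer cells. The mass already matched stays inside coarse cells and contributes
equally to both measures there; it cancels, and the new leftovers are again exact excess masses. -/
lemma HasPartialCoupling.coarsen [IsFiniteMeasure ν₀] [IsFiniteMeasure ν₁] {c c' : E → ι}
    (hc : Measurable c) (hc' : Measurable c') (hcc : ∀ x y, c x = c y → c' x = c' y)
    {D : ι → ℝ≥0∞} (hD : ∀ x y, c' x = c' y → cost (x, y) ≤ D (c x) + D (c y)) {B : ℝ≥0∞}
    (h : HasPartialCoupling cost ν₀ ν₁ c B) :
    HasPartialCoupling cost ν₀ ν₁ c' (B + ∑' i, D i *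
      ((ν₀ (c ⁻¹' {i}) - ν₁ (c ⁻¹' {i})) + (ν₁ (c ⁻¹' {i}) - ν₀ (c ⁻¹' {i})))) := by
  obtain ⟨π, σ₀, σ₁, h0, h1, hae, hσ, hB⟩ := h
  have hle0 : σ₀ ≤ ν₀ := by rw [← h0]; exact Measure.le_add_left le_rfl
  have hle1 : σ₁ ≤ ν₁ := by rw [← h1]; exact Measure.le_add_left le_rfl
  have hpl0 : π.map Prod.fst ≤ ν₀ := by rw [← h0]; exact Measure.le_add_right le_rfl
  have : IsFiniteMeasure σ₀ := isFiniteMeasure_of_le ν₀ hle0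
  have : IsFiniteMeasure σ₁ := isFiniteMeasure_of_le ν₁ hle1
  obtain ⟨π', τ₀, τ₁, h0', h1', hae', hτ⟩ := exists_cellwise_coupling σ₀ σ₁ hc'
  have hmass : ∀ i, π.map Prod.fst (c' ⁻¹' {i}) = π.map Prod.snd (c' ⁻¹' {i}) := fun i => by
    have hi : MeasurableSet (c' ⁻¹' {i}) := hc' (measurableSet_singleton i)
    rw [Measure.map_apply measurable_fst hi, Measure.map_apply measurable_snd hi]
    refine measure_congr (hae.mono fun z hz => ?_)
    have := hcc _ _ hz
    change (c' z.1 = i) = (c' z.2 = i)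
    rw [this]
  have hfin : ∀ i, π.map Prod.fst (c' ⁻¹' {i}) ≠ ∞ := fun i =>
    ((hpl0 _).trans_lt (measure_lt_top _ _)).ne
  have hν0 : ∀ i, ν₀ (c' ⁻¹' {i}) = π.map Prod.fst (c' ⁻¹' {i}) + σ₀ (c' ⁻¹' {i}) := fun i => by
    rw [← Measure.add_apply, h0]
  have hν1 : ∀ i, ν₁ (c' ⁻¹' {i}) = π.map Prod.fst (c' ⁻¹' {i}) + σ₁ (c' ⁻¹' {i}) := fun i => by
    rw [hmass, ← Measure.add_apply, h1]
  refine ⟨π + π', τ₀, τ₁, ?_, ?_, ?_, fun i => ⟨?_, ?_⟩, ?_⟩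
  · rw [Measure.map_add _ _ measurable_fst, add_assoc, h0', h0]
  · rw [Measure.map_add _ _ measurable_snd, add_assoc, h1', h1]
  · rw [ae_add_measure_iff]
    exact ⟨hae.mono fun z hz => hcc _ _ hz, hae'⟩
  · rw [(hτ i).1, hν0, hν1, ENNReal.add_sub_add_eq_sub_left (hfin i)]
  · rw [(hτ i).2, hν0, hν1, ENNReal.add_sub_add_eq_sub_left (hfin i)]
  · rw [lintegral_add_measure]
    refine add_le_add hB ?_
    have hDm : Measurable fun x => D (c x) := (measurable_of_countable D).comp hc
    calc ∫⁻ z, cost z ∂π' ≤ ∫⁻ z, (D (c z.1) + D (c z.2)) ∂π' :=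
          lintegral_mono_ae (hae'.mono fun z hz => hD _ _ hz)
      _ = ∫⁻ x, D (c x) ∂(π'.map Prod.fst) + ∫⁻ y, D (c y) ∂(π'.map Prod.snd) := by
          rw [lintegral_add_left (f := fun z : E × E => D (c z.1))
            (hDm.comp measurable_fst), lintegral_map hDm measurable_fst,
            lintegral_map hDm measurable_snd]
      _ ≤ ∫⁻ x, D (c x) ∂σ₀ + ∫⁻ y, D (c y) ∂σ₁ :=
          add_le_add
            (lintegral_mono' (by rw [← h0']; exact Measure.le_add_right le_rfl) le_rfl)
            (lintegral_mono' (by rw [← h1']; exact Measure.le_add_right le_rfl) le_rfl)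
      _ = _ := by
          rw [lintegral_comp_countable hc, lintegral_comp_countable hc, ← ENNReal.tsum_add]
          refine tsum_congr fun i => ?_
          rw [(hσ i).1, (hσ i).2, mul_add]

/-- The multiscale upper bound on the transport cost along a refining sequence of countable
partitions whose coarsest member is trivial. -/
lemma exists_coupling_lintegral_le [IsProbabilityMeasure ν₀] [IsProbabilityMeasure ν₁]
    {c : ℕ → E → ι} (hc : ∀ k, Measurable (c k)) (hc0 : ∀ x y, c 0 x = c 0 y)
    (href : ∀ k x y, c (k + 1) x = c (k + 1) y → c k x = c k y)
    {D : ℕ → ι → ℝ≥0∞}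
    (hD : ∀ k x y, c k x = c k y → cost (x, y) ≤ D k (c (k + 1) x) + D k (c (k + 1) y))
    {D' : ι → ℝ≥0∞} (L : ℕ) (hD' : ∀ x y, c L x = c L y → cost (x, y) ≤ D' (c L y)) :
    ∃ π : Measure (E × E), (π.map Prod.fst = ν₀ ∧ π.map Prod.snd = ν₁) ∧
      ∫⁻ z, cost z ∂π ≤ ∑' i, D' i * ν₁ (c L ⁻¹' {i}) + ∑ k ∈ Finset.range L, ∑' i, D k i *
        ((ν₀ (c (k + 1) ⁻¹' {i}) - ν₁ (c (k + 1) ⁻¹' {i})) +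
          (ν₁ (c (k + 1) ⁻¹' {i}) - ν₀ (c (k + 1) ⁻¹' {i}))) := by
  have key : ∀ (L : ℕ) (B : ℝ≥0∞), HasPartialCoupling cost ν₀ ν₁ (c L) B →
      HasPartialCoupling cost ν₀ ν₁ (c 0) (B + ∑ k ∈ Finset.range L, ∑' i, D k i *
        ((ν₀ (c (k + 1) ⁻¹' {i}) - ν₁ (c (k + 1) ⁻¹' {i})) +
          (ν₁ (c (k + 1) ⁻¹' {i}) - ν₀ (c (k + 1) ⁻¹' {i})))) := by
    intro L
    induction L with
    | zero => intro B h; simpa using h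
    | succ L ih =>
      intro B h
      have := ih _ (h.coarsen (hc _) (hc _) (href L) (hD L))
      rwa [Finset.sum_range_succ, add_comm (∑ k ∈ Finset.range L, _), ← add_assoc]
  obtain ⟨π, σ₀, σ₁, h0, h1, -, hσ, hB⟩ := key L _ (hasPartialCoupling_of_cost_le (hc L) D' hD')
  -- At the top the only occupied cell is the whole space. Its excess is `1 - 1 = 0`, so nothing is
  -- left over and the partial coupling is a coupling.
  obtain ⟨x₀⟩ : Nonempty E := by
    by_contra h
    rw [not_nonempty_iff] at h
    have := measure_univ (μ := ν₀)
    simp [Measure.eq_zero_of_isEmpty] at this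
  have huniv : c 0 ⁻¹' {c 0 x₀} = Set.univ := Set.eq_univ_of_forall fun x => hc0 x x₀
  have h := hσ (c 0 x₀)
  simp only [huniv, measure_univ, tsub_self, Measure.measure_univ_eq_zero] at h
  rw [h.1, add_zero] at h0
  rw [h.2, add_zero] at h1
  exact ⟨π, ⟨h0, h1⟩, hB⟩

end

/-! ### Truncated geometric sums and the exponents. -/

lemma sum_range_pow_le {r : ℝ} (hr0 : 0 ≤ r) (hr1 : r < 1) (N : ℕ) :
    ∑ n ∈ Finset.range N, r ^ n ≤ (1 - r)⁻¹ :=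
  (Summable.sum_le_tsum _ (fun n _ => pow_nonneg hr0 n)
    (summable_geometric_of_lt_one hr0 hr1)).trans_eq (tsum_geometric_of_lt_one hr0 hr1)

lemma sum_geometric_min_le_const {r s y : ℝ} (hr0 : 0 < r) (hr1 : r < 1) (N : ℕ) :
    ∑ n ∈ Finset.range N, r ^ n * min 1 (s ^ n * y) ≤ (1 - r)⁻¹ :=
  (Finset.sum_le_sum fun n _ => mul_le_of_le_one_right (pow_nonneg hr0.le n)
    (min_le_left _ _)).trans (sum_range_pow_le hr0.le hr1 N)

/-- Subcritical case: the terms `(r s)ⁿ y` are already summable, so the first scale dominates. -/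
lemma sum_geometric_min_le_of_lt {r s y : ℝ} (hr0 : 0 < r) (hs : 1 < s) (hrs : r * s < 1)
    (hy : 0 < y) (N : ℕ) :
    ∑ n ∈ Finset.range N, r ^ n * min 1 (s ^ n * y) ≤ (1 - r * s)⁻¹ * y := by
  have hs0 : 0 < s := by linarith
  calc _ ≤ ∑ n ∈ Finset.range N, (r * s) ^ n * y := by
        refine Finset.sum_le_sum fun n _ => ?_
        rw [mul_pow, mul_assoc]
        exact mul_le_mul_of_nonneg_left (min_le_right _ _) (pow_nonneg hr0.le n)
    _ ≤ _ := by
        rw [← Finset.sum_mul]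
        exact mul_le_mul_of_nonneg_right (sum_range_pow_le (by positivity) hrs N) hy.le

/-- Splitting `∑ rⁿ min(1, sⁿ y)` at the index where `sⁿ y` crosses `1`. -/
lemma exists_split_sum_geometric_min {r s y : ℝ} (hr0 : 0 < r) (hr1 : r < 1) (hs : 1 < s)
    (hy : 0 < y) (hy1 : y ≤ 1) :
    ∃ m : ℕ, s ^ m ≤ y⁻¹ ∧ y⁻¹ ≤ s ^ (m + 1) ∧ m ≤ Real.log y⁻¹ / Real.log s ∧
      ∀ N : ℕ, ∑ n ∈ Finset.range N, r ^ n * min 1 (s ^ n * y) ≤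
        y * ∑ n ∈ Finset.range (m + 1), (r * s) ^ n + (1 - r)⁻¹ * r ^ (m + 1) := by
  have hs0 : 0 < s := by linarith
  have hls : 0 < Real.log s := Real.log_pos hs
  have hyi : 1 ≤ y⁻¹ := (one_le_inv₀ hy).2 hy1
  have hly : 0 ≤ Real.log y⁻¹ := Real.log_nonneg hyi
  have hyi0 : 0 < y⁻¹ := by positivity
  refine ⟨⌊Real.log y⁻¹ / Real.log s⌋₊, ?_, ?_, Nat.floor_le (by positivity), fun N => ?_⟩
  · have h := Nat.floor_le (show 0 ≤ Real.log y⁻¹ / Real.log s by positivity)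
    rw [le_div_iff₀ hls, ← Real.log_pow] at h
    exact (Real.log_le_log_iff (by positivity) hyi0).1 h
  · have h := (Nat.lt_floor_add_one (Real.log y⁻¹ / Real.log s)).le
    rw [div_le_iff₀ hls] at h
    refine (Real.log_le_log_iff hyi0 (by positivity)).1 ?_
    rw [Real.log_pow]
    push_cast
    exact h
  · set m := ⌊Real.log y⁻¹ / Real.log s⌋₊
    have hnn : ∀ n, 0 ≤ r ^ n * min 1 (s ^ n * y) := fun n =>
      mul_nonneg (by positivity) (le_min zero_le_one (by positivity))
    calc _ ≤ ∑ n ∈ Finset.range (m + 1 + N), r ^ n * min 1 (s ^ n * y) :=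
          Finset.sum_le_sum_of_subset_of_nonneg (Finset.range_mono (by omega)) fun n _ _ => hnn n
      _ = ∑ n ∈ Finset.range (m + 1), r ^ n * min 1 (s ^ n * y) +
          ∑ j ∈ Finset.range N, r ^ (m + 1 + j) * min 1 (s ^ (m + 1 + j) * y) :=
          Finset.sum_range_add _ _ _
      _ ≤ y * ∑ n ∈ Finset.range (m + 1), (r * s) ^ n +
          ∑ j ∈ Finset.range N, r ^ j * r ^ (m + 1) := by
          rw [Finset.mul_sum]
          refine add_le_add (Finset.sum_le_sum fun n _ => ?_) (Finset.sum_le_sum fun j _ => ?_)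
          · rw [mul_pow, mul_comm y, mul_assoc]
            exact mul_le_mul_of_nonneg_left (min_le_right _ _) (pow_nonneg hr0.le n)
          · rw [← pow_add, add_comm j]
            exact mul_le_of_le_one_right (pow_nonneg hr0.le _) (min_le_left _ _)
      _ ≤ _ := by
          rw [← Finset.sum_mul]
          gcongr
          exact sum_range_pow_le hr0.le hr1 N

/-- Critical case: each index up to the crossing contributes at most `y`, and there are about `log
y⁻¹ / log s` of them. This is the source of both logarithms. -/
lemma sum_geometric_min_le_of_eq {r s y : ℝ} (hr0 : 0 < r) (hr1 : r < 1) (hs : 1 < s)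
    (hrs : r * s = 1) (hy : 0 < y) (hy1 : y ≤ 1) (N : ℕ) :
    ∑ n ∈ Finset.range N, r ^ n * min 1 (s ^ n * y) ≤
      (1 + (1 - r)⁻¹ + (Real.log s)⁻¹ * Real.log y⁻¹) * y := by
  have hs0 : 0 < s := by linarith
  obtain ⟨m, -, h2, h3, h⟩ := exists_split_sum_geometric_min hr0 hr1 hs hy hy1
  refine (h N).trans ?_
  have hr : r = s⁻¹ := eq_inv_of_mul_eq_one_left hrs
  have h4 : r ^ (m + 1) ≤ y := by
    rw [hr, inv_pow]
    exact inv_le_of_inv_le₀ hy h2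
  have h5 : 0 ≤ (1 - r)⁻¹ := inv_nonneg.2 (by linarith)
  simp only [hrs, one_pow, Finset.sum_const, Finset.card_range, nsmul_eq_mul, mul_one]
  push_cast
  have h6 : (1 - r)⁻¹ * r ^ (m + 1) ≤ (1 - r)⁻¹ * y := mul_le_mul_of_nonneg_left h4 h5
  have h7 : y * (m + 1) ≤ y * (Real.log y⁻¹ / Real.log s + 1) := by gcongr
  rw [div_eq_mul_inv] at h7
  nlinarith

/-- Supercritical case: the sum concentrates at the crossing `s^m ≈ y⁻¹`, where `r^m = s^(-θ m) ≈
y^θ`. -/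
lemma sum_geometric_min_le_of_gt {r s y θ : ℝ} (hr0 : 0 < r) (hr1 : r < 1) (hs : 1 < s)
    (hrs : 1 < r * s) (hθ : r = s ^ (-θ)) (hy : 0 < y) (hy1 : y ≤ 1) (N : ℕ) :
    ∑ n ∈ Finset.range N, r ^ n * min 1 (s ^ n * y) ≤
      (r * s * (r * s - 1)⁻¹ + (1 - r)⁻¹) * y ^ θ := by
  have hs0 : 0 < s := by linarith
  have hθ0 : 0 < θ := by
    by_contra h
    rw [hθ] at hr1
    exact absurd (Real.one_le_rpow hs.le (by linarith)) (not_le.2 hr1)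
  have hθ1 : r * s = s ^ (1 - θ) := by
    rw [hθ, sub_eq_neg_add, Real.rpow_add hs0, Real.rpow_one]
  have hθ2 : 0 < 1 - θ := by
    by_contra h
    rw [hθ1] at hrs
    exact absurd (Real.rpow_le_one_of_one_le_of_nonpos hs.le (by linarith)) (not_le.2 hrs)
  obtain ⟨m, h1, h2, -, h⟩ := exists_split_sum_geometric_min hr0 hr1 hs hy hy1
  refine (h N).trans ?_
  have h4 : r ^ (m + 1) ≤ y ^ θ := by
    rw [hθ, ← Real.rpow_natCast, ← Real.rpow_mul hs0.le, mul_comm, Real.rpow_mul hs0.le,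
      Real.rpow_natCast, Real.rpow_neg (by positivity), ← Real.inv_rpow (by positivity)]
    exact Real.rpow_le_rpow (by positivity) (inv_le_of_inv_le₀ hy h2) hθ0.le
  have h5 : 0 ≤ (1 - r)⁻¹ := inv_nonneg.2 (by linarith)
  have h6 : y * (r * s) ^ m ≤ y ^ θ := by
    have : (r * s) ^ m ≤ y⁻¹ ^ (1 - θ) := by
      rw [hθ1, ← Real.rpow_natCast, ← Real.rpow_mul hs0.le, mul_comm, Real.rpow_mul hs0.le,
        Real.rpow_natCast]
      exact Real.rpow_le_rpow (by positivity) h1 hθ2.le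
    calc y * (r * s) ^ m ≤ y * y⁻¹ ^ (1 - θ) := by gcongr
      _ = y ^ θ := by
        rw [Real.inv_rpow hy.le, ← Real.rpow_neg hy.le]
        nth_rewrite 1 [← Real.rpow_one y]
        rw [← Real.rpow_add hy]
        congr 1; ring
  have h7 : ∑ n ∈ Finset.range (m + 1), (r * s) ^ n ≤ (r * s) ^ (m + 1) * (r * s - 1)⁻¹ := by
    rw [geom_sum_eq hrs.ne', div_eq_mul_inv]
    have : 0 ≤ (r * s - 1)⁻¹ := inv_nonneg.2 (by linarith)
    nlinarith
  have h8 : 0 ≤ (r * s - 1)⁻¹ := inv_nonneg.2 (by linarith)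
  calc _ ≤ y * ((r * s) ^ (m + 1) * (r * s - 1)⁻¹) + (1 - r)⁻¹ * y ^ θ := by gcongr
    _ = r * s * (r * s - 1)⁻¹ * (y * (r * s) ^ m) + (1 - r)⁻¹ * y ^ θ := by rw [pow_succ]; ring
    _ ≤ r * s * (r * s - 1)⁻¹ * y ^ θ + (1 - r)⁻¹ * y ^ θ := by gcongr
    _ = _ := by ring

lemma gammaTwo_lt_one {p : ℝ} (hp : 0 < p) {d : ℕ} (hd : 0 < d) : gammaTwo p d < 1 := by
  have : 0 < p / d := by positivity
  exact max_lt (by norm_num) (by linarith)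

lemma one_le_log_mul {T : ℝ} (hT : 2 ≤ T) : 1 ≤ (Real.log 2)⁻¹ * Real.log T := by
  have h2 : 0 < Real.log 2 := Real.log_pos (by norm_num)
  rw [inv_mul_eq_div, one_le_div h2]
  exact Real.log_le_log (by norm_num) hT

/-- The sum over the scales inside one dyadic ring. -/
lemma exists_sum_scales_le {p : ℝ} (hp : 0 < p) {d : ℕ} (hd : 0 < d) :
    ∃ C : ℝ, 0 < C ∧ ∀ T u : ℝ, 2 ≤ T → 0 < u → u ≤ T → ∀ N : ℕ,
      ∑ k ∈ Finset.range N, ((2 : ℝ) ^ (-p)) ^ k *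
          min 1 (((2 : ℝ) ^ ((d : ℝ) / 2)) ^ k * u ^ (-(1 / 2) : ℝ)) ≤
        C * (if p = (d : ℝ) / 2 then Real.log T else 1) * min 1 (u ^ (-(1 - gammaTwo p d))) := by
  set r : ℝ := (2 : ℝ) ^ (-p) with hr
  set s : ℝ := (2 : ℝ) ^ ((d : ℝ) / 2) with hs_def
  have hd' : (0 : ℝ) < d := by exact_mod_cast hd
  have hr0 : 0 < r := by positivity
  have hr1 : r < 1 := Real.rpow_lt_one_of_one_lt_of_neg (by norm_num) (by linarith)
  have hs : 1 < s := Real.one_lt_rpow (by norm_num) (by positivity)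
  have hrs : r * s = (2 : ℝ) ^ ((d : ℝ) / 2 - p) := by
    rw [hr, hs_def, ← Real.rpow_add two_pos]; congr 1; ring
  have hinv : 0 < (1 - r)⁻¹ := inv_pos.2 (by linarith)
  have hγ := gammaTwo_lt_one hp hd
  set Λ : ℝ → ℝ := fun T => if p = (d : ℝ) / 2 then Real.log T else 1
  -- Since `T ≥ 2`, the possible logarithm is bounded below and can absorb constants.
  have hΛ : ∃ K : ℝ, 0 < K ∧ ∀ T, 2 ≤ T → 1 ≤ K * Λ T := by
    by_cases h : p = (d : ℝ) / 2
    · exact ⟨(Real.log 2)⁻¹, inv_pos.2 (Real.log_pos (by norm_num)), fun T hT => by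
        simp only [Λ, if_pos h]; exact one_le_log_mul hT⟩
    · exact ⟨1, one_pos, fun T _ => by simp [Λ, if_neg h]⟩
  obtain ⟨K, hK, hKΛ⟩ := hΛ
  have hΛ0 : ∀ T, 2 ≤ T → 0 < Λ T := fun T hT =>
    pos_of_mul_pos_right (lt_of_lt_of_le one_pos (hKΛ T hT)) hK.le
  -- it suffices to treat `1 ≤ u`
  suffices H : ∃ C : ℝ, 0 < C ∧ ∀ T u : ℝ, 2 ≤ T → 1 ≤ u → u ≤ T → ∀ N : ℕ,
      ∑ k ∈ Finset.range N, r ^ k * min 1 (s ^ k * u ^ (-(1 / 2) : ℝ)) ≤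
        C * Λ T * u ^ (-(1 - gammaTwo p d)) by
    obtain ⟨C, hC, H⟩ := H
    refine ⟨C + (1 - r)⁻¹ * K, by positivity, fun T u hT hu huT N => ?_⟩
    have hΛT := hΛ0 T hT
    change _ ≤ (C + (1 - r)⁻¹ * K) * Λ T * _
    rcases le_total 1 u with h1 | h1
    · rw [min_eq_right (Real.rpow_le_one_of_one_le_of_nonpos h1 (by linarith))]
      refine (H T u hT h1 huT N).trans ?_
      gcongr
      have : 0 < (1 - r)⁻¹ * K := by positivity
      linarith
    · rw [min_eq_left (Real.one_le_rpow_of_pos_of_le_one_of_nonpos hu h1 (by linarith)), mul_one]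
      refine (sum_geometric_min_le_const hr0 hr1 N).trans ?_
      have h2 := hKΛ T hT
      have h3 : 0 < C * Λ T := by positivity
      nlinarith
  have hy : ∀ u : ℝ, 1 ≤ u → 0 < u ^ (-(1 / 2) : ℝ) ∧ u ^ (-(1 / 2) : ℝ) ≤ 1 := fun u hu =>
    ⟨by positivity, Real.rpow_le_one_of_one_le_of_nonpos hu (by norm_num)⟩
  rcases lt_trichotomy p ((d : ℝ) / 2) with h | h | h
  · have hg : gammaTwo p d = 1 - p / d := by
      refine max_eq_right ?_
      rw [le_sub_comm, div_le_iff₀ hd']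
      linarith
    have hrs1 : 1 < r * s := by
      rw [hrs]; exact Real.one_lt_rpow (by norm_num) (by linarith)
    refine ⟨r * s * (r * s - 1)⁻¹ + (1 - r)⁻¹, ?_, fun T u hT hu huT N => ?_⟩
    · have : 0 < (r * s - 1)⁻¹ := inv_pos.2 (by linarith)
      positivity
    · have hu0 : 0 < u := by linarith
      -- Here `2^(-p) = (2^(d/2))^(-θ)` forces `θ = 2p/d`, and `(u^(-1/2))^θ = u^(-p/d)`.
      refine (sum_geometric_min_le_of_gt (θ := 2 * p / d) hr0 hr1 hs hrs1 ?_ (hy u hu).1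
        (hy u hu).2 N).trans_eq ?_
      · rw [hr, hs_def, ← Real.rpow_mul two_pos.le]
        congr 1; field_simp
      · simp only [Λ, if_neg h.ne, mul_one]
        rw [← Real.rpow_mul hu0.le, hg]
        congr 2; field_simp; ring
  · have hg : gammaTwo p d = 1 / 2 := by
      refine max_eq_left ?_
      rw [h]
      have : (d : ℝ) / 2 / d = 1 / 2 := by field_simp
      linarith
    have hrs1 : r * s = 1 := by rw [hrs, h]; simp
    have hls : 0 < (Real.log s)⁻¹ := inv_pos.2 (Real.log_pos hs)
    refine ⟨(1 + (1 - r)⁻¹) * K + (Real.log s)⁻¹, by positivity, fun T u hT hu huT N => ?_⟩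
    have hu0 : 0 < u := by linarith
    refine (sum_geometric_min_le_of_eq hr0 hr1 hs hrs1 (hy u hu).1 (hy u hu).2 N).trans ?_
    -- The bound `u ≤ T` is needed here: the logarithm of `u` is traded for `log T`, uniformly over
    -- the rings.
    have e1 : Real.log (u ^ (-(1 / 2) : ℝ))⁻¹ ≤ Λ T := by
      simp only [Λ, if_pos h]
      rw [Real.log_inv, Real.log_rpow hu0]
      have := Real.log_le_log hu0 huT
      have := Real.log_nonneg hu
      linarith
    rw [hg, show (-(1 - 1 / 2) : ℝ) = -(1 / 2) by norm_num]
    refine mul_le_mul_of_nonneg_right ?_ (hy u hu).1.le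
    have h2 := hKΛ T hT
    have h3 : (Real.log s)⁻¹ * Real.log (u ^ (-(1 / 2) : ℝ))⁻¹ ≤ (Real.log s)⁻¹ * Λ T := by gcongr
    nlinarith
  · have hg : gammaTwo p d = 1 / 2 := by
      refine max_eq_left ?_
      rw [sub_le_comm, le_div_iff₀ hd']
      linarith
    have hrs1 : r * s < 1 := by
      rw [hrs]; exact Real.rpow_lt_one_of_one_lt_of_neg (by norm_num) (by linarith)
    refine ⟨(1 - r * s)⁻¹, inv_pos.2 (by linarith), fun T u hT hu huT N => ?_⟩
    refine (sum_geometric_min_le_of_lt hr0 hs hrs1 (hy u hu).1 N).trans_eq ?_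
    simp only [Λ, if_neg h.ne', mul_one]
    rw [hg]
    congr 2; norm_num

/-- The sum over the dyadic rings. -/
lemma exists_sum_rings_le {p q γ : ℝ} (hp : 0 < p) (hpq : p < q) (hγ : γ < 1) :
    ∃ C : ℝ, 0 < C ∧ ∀ T : ℝ, 2 ≤ T → ∀ N : ℕ,
      ∑ n ∈ Finset.range N, ((2 : ℝ) ^ p) ^ n * (((2 : ℝ) ^ (-q)) ^ n *
          min 1 ((((2 : ℝ) ^ (-q)) ^ n * T) ^ (-(1 - γ)))) ≤
        C * T ^ (-(1 - max γ (p / q))) * (if γ * q = p then Real.log T else 1) := by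
  have hq : 0 < q := hp.trans hpq
  set r : ℝ := (2 : ℝ) ^ (p - q) with hr
  set s : ℝ := (2 : ℝ) ^ (q * (1 - γ)) with hs_def
  have hr0 : 0 < r := by positivity
  have hr1 : r < 1 := Real.rpow_lt_one_of_one_lt_of_neg (by norm_num) (by linarith)
  have hs : 1 < s := Real.one_lt_rpow (by norm_num) (mul_pos hq (by linarith))
  have hrs : r * s = (2 : ℝ) ^ (p - γ * q) := by
    rw [hr, hs_def, ← Real.rpow_add two_pos]; congr 1; ring
  have hinv : 0 < (1 - r)⁻¹ := inv_pos.2 (by linarith)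
  have hterm : ∀ T : ℝ, 2 ≤ T → ∀ n : ℕ, ((2 : ℝ) ^ p) ^ n * (((2 : ℝ) ^ (-q)) ^ n *
      min 1 ((((2 : ℝ) ^ (-q)) ^ n * T) ^ (-(1 - γ)))) =
      r ^ n * min 1 (s ^ n * T ^ (-(1 - γ))) := by
    intro T hT n
    have hT0 : 0 < T := by linarith
    rw [← mul_assoc, ← mul_pow, ← Real.rpow_add two_pos, ← sub_eq_add_neg,
      Real.mul_rpow (by positivity) hT0.le, ← Real.rpow_natCast ((2 : ℝ) ^ (-q)),
      ← Real.rpow_mul two_pos.le, ← Real.rpow_mul two_pos.le, hs_def,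
      ← Real.rpow_natCast ((2 : ℝ) ^ (q * (1 - γ))), ← Real.rpow_mul two_pos.le]
    congr 4; ring
  have hy : ∀ T : ℝ, 2 ≤ T → 0 < T ^ (-(1 - γ)) ∧ T ^ (-(1 - γ)) ≤ 1 := fun T hT =>
    ⟨Real.rpow_pos_of_pos (by linarith) _,
      Real.rpow_le_one_of_one_le_of_nonpos (by linarith) (by linarith)⟩
  rcases lt_trichotomy p (γ * q) with h | h | h
  · have hmax : max γ (p / q) = γ := max_eq_left (by rw [div_le_iff₀ hq]; exact h.le)
    have hrs1 : r * s < 1 := by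
      rw [hrs]; exact Real.rpow_lt_one_of_one_lt_of_neg (by norm_num) (by linarith)
    refine ⟨(1 - r * s)⁻¹, inv_pos.2 (by linarith), fun T hT N => ?_⟩
    rw [Finset.sum_congr rfl fun n _ => hterm T hT n, hmax, if_neg h.ne', mul_one]
    exact sum_geometric_min_le_of_lt hr0 hs hrs1 (hy T hT).1 N
  · have hmax : max γ (p / q) = γ := max_eq_left (by rw [div_le_iff₀ hq]; exact h.le)
    have hrs1 : r * s = 1 := by rw [hrs, h]; simp
    have hls : 0 < (Real.log s)⁻¹ := inv_pos.2 (Real.log_pos hs)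
    have hl2 : 0 < (Real.log 2)⁻¹ := inv_pos.2 (Real.log_pos (by norm_num))
    refine ⟨(1 + (1 - r)⁻¹) * (Real.log 2)⁻¹ + (Real.log s)⁻¹ * (1 - γ), ?_, fun T hT N => ?_⟩
    · have : 0 < 1 - γ := by linarith
      positivity
    · have hT0 : 0 < T := by linarith
      rw [Finset.sum_congr rfl fun n _ => hterm T hT n, hmax, if_pos h.symm]
      refine (sum_geometric_min_le_of_eq hr0 hr1 hs hrs1 (hy T hT).1 (hy T hT).2 N).trans ?_
      rw [Real.log_inv, Real.log_rpow hT0, mul_right_comm]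
      refine mul_le_mul_of_nonneg_right ?_ (hy T hT).1.le
      have h1 := one_le_log_mul hT
      nlinarith
  · have hmax : max γ (p / q) = p / q := max_eq_right (by rw [le_div_iff₀ hq]; exact h.le)
    have hrs1 : 1 < r * s := by
      rw [hrs]; exact Real.one_lt_rpow (by norm_num) (by linarith)
    have hγ0 : 1 - γ ≠ 0 := by linarith
    refine ⟨r * s * (r * s - 1)⁻¹ + (1 - r)⁻¹, ?_, fun T hT N => ?_⟩
    · have : 0 < (r * s - 1)⁻¹ := inv_pos.2 (by linarith)
      positivity
    · have hT0 : 0 < T := by linarith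
      rw [Finset.sum_congr rfl fun n _ => hterm T hT n, hmax, if_neg h.ne, mul_one]
      -- This `θ` solves `2^(p-q) = (2^(q(1-γ)))^(-θ)`; then `(T^(-(1-γ)))^θ = T^(-(1-p/q))`.
      refine (sum_geometric_min_le_of_gt (θ := (q - p) / (q * (1 - γ))) hr0 hr1 hs hrs1 ?_
        (hy T hT).1 (hy T hT).2 N).trans_eq ?_
      · rw [hr, hs_def, ← Real.rpow_mul two_pos.le]
        congr 1; field_simp; ring
      · rw [← Real.rpow_mul hT0.le]
        congr 2; field_simp

/-! ### Dyadic rings and cells in Euclidean space. -/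

section Dyadic

variable {d : ℕ}

/-- The index of the dyadic ring containing `x`: the least `n` with `‖x‖ ≤ 2 ^ n`. -/
noncomputable def dyadicRing (x : EuclideanSpace ℝ (Fin d)) : ℕ := Nat.clog 2 ⌈‖x‖⌉₊

lemma dyadicRing_le_iff {x : EuclideanSpace ℝ (Fin d)} {n : ℕ} :
    dyadicRing x ≤ n ↔ ‖x‖ ≤ 2 ^ n := by
  rw [dyadicRing, Nat.clog_le_iff_le_pow one_lt_two, Nat.ceil_le]
  push_cast
  rfl

lemma norm_le_two_pow_dyadicRing (x : EuclideanSpace ℝ (Fin d)) : ‖x‖ ≤ 2 ^ dyadicRing x :=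
  dyadicRing_le_iff.1 le_rfl

lemma measurable_dyadicRing : Measurable (dyadicRing : EuclideanSpace ℝ (Fin d) → ℕ) :=
  (measurable_from_top (f := fun m : ℕ => Nat.clog 2 m)).comp (Nat.measurable_ceil.comp measurable_norm)

/-- The dyadic cell of level `l` containing `x`; its side is `2 ^ (n - l)` in the `n`-th ring. -/
noncomputable def dyadicCell (l : ℕ) (x : EuclideanSpace ℝ (Fin d)) : ℕ × (Fin d → ℤ) :=
  (dyadicRing x, fun i => ⌊x i * 2 ^ l / 2 ^ dyadicRing x⌋)

lemma measurable_dyadicCell (l : ℕ) :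
    Measurable (dyadicCell l : EuclideanSpace ℝ (Fin d) → ℕ × (Fin d → ℤ)) := by
  refine measurable_dyadicRing.prodMk (measurable_pi_lambda _ fun i => Int.measurable_floor.comp ?_)
  have h1 : Measurable fun x : EuclideanSpace ℝ (Fin d) => x i := by fun_prop
  have h2 : Measurable fun x : EuclideanSpace ℝ (Fin d) => (2 : ℝ) ^ dyadicRing x :=
    (measurable_from_top (f := fun n : ℕ => (2 : ℝ) ^ n)).comp measurable_dyadicRing
  exact (h1.mul_const _).div h2

/-- One half of the fact that `⌊2a⌋` determines `⌊a⌋`, which makes halved cubes refine their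
parents. -/
lemma floor_le_floor_of_floor_two_mul_eq {a b : ℝ} (h : ⌊2 * a⌋ = ⌊2 * b⌋) : ⌊a⌋ ≤ ⌊b⌋ := by
  rw [Int.le_floor]
  have h1 : 2 * ⌊a⌋ ≤ ⌊2 * b⌋ := by
    rw [← h, Int.le_floor]
    push_cast
    linarith [Int.floor_le a]
  rw [Int.le_floor] at h1
  push_cast at h1
  linarith

lemma dyadicCell_eq_of_succ {l : ℕ} {x y : EuclideanSpace ℝ (Fin d)}
    (h : dyadicCell (l + 1) x = dyadicCell (l + 1) y) : dyadicCell l x = dyadicCell l y := by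
  simp only [dyadicCell, Prod.mk.injEq] at h ⊢
  obtain ⟨hr, hc⟩ := h
  refine ⟨hr, funext fun i => ?_⟩
  have hi := congrFun hc i
  simp only [pow_succ] at hi
  have e : ∀ a b : ℝ, a * (2 ^ l * 2) / b = 2 * (a * 2 ^ l / b) := fun a b => by ring
  rw [e, e] at hi
  exact le_antisymm (floor_le_floor_of_floor_two_mul_eq hi)
    (floor_le_floor_of_floor_two_mul_eq hi.symm)

lemma norm_le_of_abs_le {v : EuclideanSpace ℝ (Fin d)} {δ : ℝ} (hδ : 0 ≤ δ)
    (h : ∀ i, |v i| ≤ δ) : ‖v‖ ≤ d * δ := by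
  rw [EuclideanSpace.norm_eq]
  refine Real.sqrt_le_iff.2 ⟨by positivity, ?_⟩
  calc ∑ i, ‖v i‖ ^ 2 ≤ ∑ _i : Fin d, δ ^ 2 :=
        Finset.sum_le_sum fun i _ => pow_le_pow_left₀ (norm_nonneg _) (h i) 2
    _ = d * δ ^ 2 := by simp
    _ ≤ (d : ℝ) ^ 2 * δ ^ 2 := by
        refine mul_le_mul_of_nonneg_right ?_ (sq_nonneg δ)
        exact_mod_cast Nat.le_self_pow two_ne_zero d
    _ = (d * δ) ^ 2 := by ring

lemma norm_sub_le_of_dyadicCell_eq {l : ℕ} {x y : EuclideanSpace ℝ (Fin d)}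
    (h : dyadicCell l x = dyadicCell l y) : ‖x - y‖ ≤ d * (2 ^ dyadicRing y / 2 ^ l) := by
  simp only [dyadicCell, Prod.mk.injEq] at h
  obtain ⟨hr, hc⟩ := h
  refine norm_le_of_abs_le (by positivity) fun i => ?_
  have hi := Int.abs_sub_lt_one_of_floor_eq_floor (congrFun hc i)
  rw [hr, ← sub_div, ← sub_mul, abs_div, abs_mul, abs_of_pos (show (0 : ℝ) < 2 ^ l by positivity),
    abs_of_pos (show (0 : ℝ) < 2 ^ dyadicRing y by positivity), div_lt_one (by positivity)] at hi
  rw [le_div_iff₀ (by positivity)]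
  exact hi.le

/-- The labels of the level-`l` cells of a ring. -/
noncomputable def dyadicLabels (d l : ℕ) : Finset (Fin d → ℤ) :=
  Fintype.piFinset fun _ => Finset.Icc (-2 ^ l) (2 ^ l)

lemma card_dyadicLabels_le (d l : ℕ) : ((dyadicLabels d l).card : ℝ) ≤ 3 ^ d * (2 ^ d) ^ l := by
  have h : (dyadicLabels d l).card ≤ (3 * 2 ^ l) ^ d := by
    rw [dyadicLabels, Fintype.card_piFinset_const, Int.card_Icc]
    -- Each coordinate has `2 · 2^l + 1 ≤ 3 · 2^l` labels; the endpoint `2^l` can occur because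
    -- rings are closed on the outside.
    refine Nat.pow_le_pow_left ?_ d
    have : (1 : ℤ) ≤ 2 ^ l := one_le_pow₀ (by norm_num)
    zify
    rw [Int.toNat_of_nonneg (by linarith)]
    linarith
  calc ((dyadicLabels d l).card : ℝ) ≤ ((3 * 2 ^ l) ^ d : ℕ) := by exact_mod_cast h
    _ = _ := by push_cast; rw [mul_pow, ← pow_mul, ← pow_mul, mul_comm l]

lemma snd_dyadicCell_mem (l : ℕ) (x : EuclideanSpace ℝ (Fin d)) :
    (dyadicCell l x).2 ∈ dyadicLabels d l := by
  rw [dyadicLabels, Fintype.mem_piFinset]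
  intro i
  have h0 : (0 : ℝ) < 2 ^ dyadicRing x := by positivity
  have h1 : |x i| ≤ 2 ^ dyadicRing x :=
    (PiLp.norm_apply_le x i).trans (norm_le_two_pow_dyadicRing x)
  have h2 : |x i * 2 ^ l / 2 ^ dyadicRing x| ≤ 2 ^ l := by
    rw [abs_div, abs_mul, abs_of_pos h0, abs_of_pos (show (0 : ℝ) < 2 ^ l by positivity),
      div_le_iff₀ h0, mul_comm]
    exact mul_le_mul_of_nonneg_left h1 (by positivity)
  rw [abs_le] at h2
  simp only [dyadicCell, Finset.mem_Icc]
  constructor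
  · rw [Int.le_floor]; push_cast; exact h2.1
  · have : (⌊x i * 2 ^ l / 2 ^ dyadicRing x⌋ : ℝ) ≤ 2 ^ l := (Int.floor_le _).trans h2.2
    have h3 : ((⌊x i * 2 ^ l / 2 ^ dyadicRing x⌋ : ℤ) : ℝ) ≤ ((2 ^ l : ℤ) : ℝ) := by
      push_cast; exact this
    exact Int.cast_le.1 h3

lemma preimage_dyadicCell_eq_empty {l n : ℕ} {F : Fin d → ℤ} (hF : F ∉ dyadicLabels d l) :
    (dyadicCell l ⁻¹' {(n, F)} : Set (EuclideanSpace ℝ (Fin d))) = ∅ := by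
  refine Set.eq_empty_of_forall_notMem fun x hx => hF ?_
  have h := snd_dyadicCell_mem l x
  rwa [Set.mem_singleton_iff.1 hx] at h

lemma sum_measure_dyadicCell (ν : Measure (EuclideanSpace ℝ (Fin d))) (l n : ℕ) :
    ∑ F ∈ dyadicLabels d l, ν (dyadicCell l ⁻¹' {(n, F)}) = ν (dyadicRing ⁻¹' {n}) := by
  rw [← measure_biUnion_finset]
  · congr 1
    ext x
    simp only [Set.mem_iUnion, Set.mem_preimage, Set.mem_singleton_iff, exists_prop]
    constructor
    · rintro ⟨F, -, h⟩; exact congrArg Prod.fst h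
    · intro h; exact ⟨_, snd_dyadicCell_mem l x, Prod.ext h rfl⟩
  · intro F _ G _ hFG
    refine Set.disjoint_left.2 fun x hx hy => hFG ?_
    have := (Set.mem_singleton_iff.1 hx).symm.trans (Set.mem_singleton_iff.1 hy)
    exact congrArg Prod.snd this
  · exact fun F _ => measurable_dyadicCell l (measurableSet_singleton _)

/-- The refining partitions: the trivial one followed by the dyadic cells. -/
noncomputable def dyadicPartition : ℕ → EuclideanSpace ℝ (Fin d) → ℕ × (Fin d → ℤ)
  | 0 => fun _ => (0, 0)
  | l + 1 => dyadicCell l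

lemma measurable_dyadicPartition : ∀ k,
    Measurable (dyadicPartition k : EuclideanSpace ℝ (Fin d) → ℕ × (Fin d → ℤ))
  | 0 => measurable_const
  | l + 1 => measurable_dyadicCell l

lemma dyadicPartition_refines : ∀ (k : ℕ) (x y : EuclideanSpace ℝ (Fin d)),
    dyadicPartition (k + 1) x = dyadicPartition (k + 1) y →
      dyadicPartition k x = dyadicPartition k y
  | 0, _, _, _ => rfl
  | _ + 1, _, _, h => dyadicCell_eq_of_succ h

/-- The weight of a matching made at scale `k` in the `n`-th ring. -/
noncomputable def scaleWeight (d : ℕ) (p : ℝ) (k n : ℕ) : ℝ :=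
  (2 * (d + 1)) ^ p * ((2 : ℝ) ^ p) ^ n * ((2 : ℝ) ^ (-p)) ^ k

lemma scaleWeight_eq (d : ℕ) (p : ℝ) (k n : ℕ) :
    scaleWeight d p k n = (2 * (d + 1) * (2 ^ n / 2 ^ k)) ^ p := by
  have e1 : (2 : ℝ) * (d + 1) * (2 ^ n / 2 ^ k) = 2 * (d + 1) * 2 ^ n * (2 ^ k)⁻¹ := by ring
  have hc : ∀ m : ℕ, ((2 : ℝ) ^ m) ^ p = (2 ^ p) ^ m := fun m => by
    rw [← Real.rpow_natCast, ← Real.rpow_natCast, ← Real.rpow_mul two_pos.le,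
      ← Real.rpow_mul two_pos.le, mul_comm]
  have hm : ∀ a b c : ℝ, 0 ≤ a → 0 ≤ b → 0 ≤ c → (a * b * c) ^ p = a ^ p * b ^ p * c ^ p :=
    fun a b c ha hb hc => by rw [Real.mul_rpow (mul_nonneg ha hb) hc, Real.mul_rpow ha hb]
  rw [scaleWeight, e1, hm _ _ _ (by positivity) (by positivity) (by positivity),
    Real.inv_rpow (by positivity), hc, hc, Real.rpow_neg two_pos.le, inv_pow]

lemma edist_rpow_le_scaleWeight {p : ℝ} (hp : 0 < p) {k n : ℕ} {x y : EuclideanSpace ℝ (Fin d)}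
    (h : ‖x - y‖ ≤ 2 * (d + 1) * (2 ^ n / 2 ^ k)) :
    edist x y ^ p ≤ ENNReal.ofReal (scaleWeight d p k n) := by
  rw [edist_dist, ENNReal.ofReal_rpow_of_nonneg dist_nonneg hp.le, scaleWeight_eq, dist_eq_norm]
  exact ENNReal.ofReal_le_ofReal (Real.rpow_le_rpow (norm_nonneg _) h hp.le)

/-- Level `l` cells are the members of index `l + 1` in `dyadicPartition`; the factor `2` in
`scaleWeight` pays for this shift. -/
lemma edist_rpow_le_of_dyadicCell_eq {p : ℝ} (hp : 0 < p) {l : ℕ}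
    {x y : EuclideanSpace ℝ (Fin d)} (h : dyadicCell l x = dyadicCell l y) :
    edist x y ^ p ≤ ENNReal.ofReal (scaleWeight d p (l + 1) (dyadicRing y)) := by
  refine edist_rpow_le_scaleWeight hp ((norm_sub_le_of_dyadicCell_eq h).trans ?_)
  have e : (2 : ℝ) * (d + 1) * (2 ^ dyadicRing y / 2 ^ (l + 1)) =
      (d + 1) * (2 ^ dyadicRing y / 2 ^ l) := by rw [pow_succ]; field_simp
  rw [e]
  gcongr
  linarith

/-- The top matching moves mass between different rings. The distance is at most twice the larger
radius, so the weight of the outer ring suffices. -/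
lemma edist_rpow_le_add {p : ℝ} (hp : 0 < p) (x y : EuclideanSpace ℝ (Fin d)) :
    edist x y ^ p ≤ ENNReal.ofReal (scaleWeight d p 0 (dyadicRing x)) +
      ENNReal.ofReal (scaleWeight d p 0 (dyadicRing y)) := by
  have hx := norm_le_two_pow_dyadicRing x
  have hy := norm_le_two_pow_dyadicRing y
  have hd : (0 : ℝ) ≤ d := Nat.cast_nonneg d
  have hxy := norm_sub_le x y
  rcases le_total (dyadicRing x) (dyadicRing y) with h | h
  · refine le_add_left (edist_rpow_le_scaleWeight hp ?_)
    have h2 : (2 : ℝ) ^ dyadicRing x ≤ 2 ^ dyadicRing y := pow_le_pow_right₀ (by norm_num) h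
    have h3 : (0 : ℝ) ≤ d * 2 ^ dyadicRing y := by positivity
    rw [pow_zero, div_one]
    linarith
  · refine le_add_right (edist_rpow_le_scaleWeight hp ?_)
    have h2 : (2 : ℝ) ^ dyadicRing y ≤ 2 ^ dyadicRing x := pow_le_pow_right₀ (by norm_num) h
    have h3 : (0 : ℝ) ≤ d * 2 ^ dyadicRing x := by positivity
    rw [pow_zero, div_one]
    linarith

lemma edist_rpow_le_of_dyadicPartition_eq {p : ℝ} (hp : 0 < p) : ∀ (k : ℕ)
    (x y : EuclideanSpace ℝ (Fin d)), dyadicPartition k x = dyadicPartition k y →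
      edist x y ^ p ≤ ENNReal.ofReal (scaleWeight d p k (dyadicPartition (k + 1) x).1) +
        ENNReal.ofReal (scaleWeight d p k (dyadicPartition (k + 1) y).1)
  | 0, x, y, _ => edist_rpow_le_add hp x y
  | _ + 1, _, _, h => le_add_left (edist_rpow_le_of_dyadicCell_eq hp h)

lemma tsum_mul_eq_tsum_sum_dyadicLabels (k : ℕ) (w : ℕ → ℝ≥0∞) {v : ℕ × (Fin d → ℤ) → ℝ≥0∞}
    (hv : ∀ n, ∀ F ∉ dyadicLabels d k, v (n, F) = 0) :
    ∑' i, w i.1 * v i = ∑' n, w n * ∑ F ∈ dyadicLabels d k, v (n, F) := by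
  rw [ENNReal.tsum_prod']
  refine tsum_congr fun n => ?_
  change ∑' F, w n * v (n, F) = _
  rw [ENNReal.tsum_mul_left, tsum_eq_sum (hv n)]

/-- The multiscale upper bound on the transport cost in Euclidean space. -/
lemma transportCost_le {p : ℝ} (hp : 0 < p) (ν₀ ν₁ : Measure (EuclideanSpace ℝ (Fin d)))
    [IsProbabilityMeasure ν₀] [IsProbabilityMeasure ν₁] (L : ℕ) :
    transportCost p ν₀ ν₁ ≤
      ∑' n, ENNReal.ofReal (scaleWeight d p (L + 1) n) * ν₁ (dyadicRing ⁻¹' {n}) +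
      ∑ k ∈ Finset.range (L + 1), ∑' n, ENNReal.ofReal (scaleWeight d p k n) *
        ∑ F ∈ dyadicLabels d k,
          ((ν₀ (dyadicCell k ⁻¹' {(n, F)}) - ν₁ (dyadicCell k ⁻¹' {(n, F)})) +
          (ν₁ (dyadicCell k ⁻¹' {(n, F)}) - ν₀ (dyadicCell k ⁻¹' {(n, F)}))) := by
  obtain ⟨π, hπ, hle⟩ := exists_coupling_lintegral_le (ν₀ := ν₀) (ν₁ := ν₁)
    (cost := fun z => edist z.1 z.2 ^ p) measurable_dyadicPartition (fun _ _ => rfl)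
    dyadicPartition_refines (D := fun k i => ENNReal.ofReal (scaleWeight d p k i.1))
    (edist_rpow_le_of_dyadicPartition_eq hp)
    (D' := fun i => ENNReal.ofReal (scaleWeight d p (L + 1) i.1)) (L + 1)
    (fun _ _ h => edist_rpow_le_of_dyadicCell_eq hp h)
  refine (iInf₂_le π hπ).trans (hle.trans (add_le_add (le_of_eq ?_) (Finset.sum_le_sum fun k _ =>
    le_of_eq ?_)))
  · simp only [dyadicPartition]
    rw [tsum_mul_eq_tsum_sum_dyadicLabels L (fun n => ENNReal.ofReal (scaleWeight d p (L + 1) n))]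
    · simp_rw [sum_measure_dyadicCell]
    · intro n F hF
      rw [preimage_dyadicCell_eq_empty hF, measure_empty]
  · simp only [dyadicPartition]
    rw [tsum_mul_eq_tsum_sum_dyadicLabels k (fun n => ENNReal.ofReal (scaleWeight d p k n))]
    intro n F hF
    rw [preimage_dyadicCell_eq_empty hF, measure_empty, measure_empty, tsub_self, add_zero]

end Dyadic

/-! ### Moment decay, expected discrepancies and the rate. -/

lemma tsum_ofReal_le {f : ℕ → ℝ} (hf : ∀ n, 0 ≤ f n) {B : ℝ}
    (h : ∀ N, ∑ n ∈ Finset.range N, f n ≤ B) : ∑' n, ENNReal.ofReal (f n) ≤ ENNReal.ofReal B :=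
  ENNReal.tsum_le_of_sum_range_le fun N => by
    rw [← ENNReal.ofReal_sum_of_nonneg fun n _ => hf n]
    exact ENNReal.ofReal_le_ofReal (h N)

lemma scaleWeight_nonneg (d : ℕ) (p : ℝ) (k n : ℕ) : 0 ≤ scaleWeight d p k n := by
  unfold scaleWeight; positivity

/-- Geometric decay of the mass of the dyadic rings under a finite `q`-th moment. -/
lemma exists_measureReal_dyadicRing_le {d : ℕ} {μ : Measure (EuclideanSpace ℝ (Fin d))}
    [IsProbabilityMeasure μ] {q : ℝ} (hq : 0 < q) (hmom : ∫⁻ x, ‖x‖ₑ ^ q ∂μ < ∞) :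
    ∃ M : ℝ, 0 < M ∧ ∀ n, μ.real (dyadicRing ⁻¹' {n}) ≤ M * ((2 : ℝ) ^ (-q)) ^ n := by
  set I : ℝ := (∫⁻ x, ‖x‖ₑ ^ q ∂μ).toReal with hI
  have hI0 : 0 ≤ I := ENNReal.toReal_nonneg
  refine ⟨2 ^ q * (1 + I), by positivity, fun n => ?_⟩
  set R : Set (EuclideanSpace ℝ (Fin d)) := dyadicRing ⁻¹' {n} with hR
  have hRm : MeasurableSet R := measurable_dyadicRing (measurableSet_singleton n)
  have hpt : ∀ x ∈ R, ENNReal.ofReal (((2 : ℝ) ^ n) ^ q) ≤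
      ENNReal.ofReal (2 ^ q) * (1 + ‖x‖ₑ ^ q) := by
    intro x hx
    have hx' : dyadicRing x = n := hx
    have hreal : ((2 : ℝ) ^ n) ^ q ≤ 2 ^ q * (1 + ‖x‖ ^ q) := by
      have h0 : 0 ≤ ‖x‖ ^ q := by positivity
      -- The ring of index `0` is the closed unit ball, where the norm has no positive lower bound;
      -- the summand `1` covers it.
      rcases n with _ | n
      · rw [pow_zero, Real.one_rpow]
        have : (1 : ℝ) ≤ 2 ^ q := Real.one_le_rpow (by norm_num) hq.le
        nlinarith
      · have h1 : (2 : ℝ) ^ n < ‖x‖ := by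
          by_contra h
          have := dyadicRing_le_iff.2 (not_lt.1 h)
          omega
        rw [pow_succ, mul_comm, Real.mul_rpow (by norm_num) (by positivity)]
        refine mul_le_mul_of_nonneg_left ?_ (by positivity)
        have := Real.rpow_le_rpow (by positivity) h1.le hq.le
        linarith
    refine (ENNReal.ofReal_le_ofReal hreal).trans_eq ?_
    rw [ENNReal.ofReal_mul (by positivity), ENNReal.ofReal_add zero_le_one (by positivity),
      ENNReal.ofReal_one, ← ENNReal.ofReal_rpow_of_nonneg (norm_nonneg x) hq.le, ofReal_norm]
  have hle : ENNReal.ofReal (((2 : ℝ) ^ n) ^ q) * μ R ≤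
      ENNReal.ofReal (2 ^ q * (1 + I)) := by
    calc _ = ∫⁻ _ in R, ENNReal.ofReal (((2 : ℝ) ^ n) ^ q) ∂μ := (setLIntegral_const _ _).symm
      _ ≤ ∫⁻ x in R, ENNReal.ofReal (2 ^ q) * (1 + ‖x‖ₑ ^ q) ∂μ := setLIntegral_mono' hRm hpt
      _ ≤ ∫⁻ x, ENNReal.ofReal (2 ^ q) * (1 + ‖x‖ₑ ^ q) ∂μ := setLIntegral_le_lintegral _ _
      _ = _ := by
        rw [lintegral_const_mul _ (by fun_prop), lintegral_add_left measurable_const,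
          lintegral_const, measure_univ, mul_one, ENNReal.ofReal_mul (by positivity),
          ENNReal.ofReal_add zero_le_one hI0, ENNReal.ofReal_one, hI,
          ENNReal.ofReal_toReal hmom.ne]
  rw [← ofReal_measureReal (μ := μ), ← ENNReal.ofReal_mul (by positivity),
    ENNReal.ofReal_le_ofReal_iff (by positivity)] at hle
  have e : ((2 : ℝ) ^ (-q)) ^ n = (((2 : ℝ) ^ n) ^ q)⁻¹ := by
    rw [← Real.rpow_natCast, ← Real.rpow_natCast, ← Real.rpow_mul two_pos.le,
      ← Real.rpow_mul two_pos.le, ← Real.rpow_neg two_pos.le]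
    congr 1; ring
  rw [e, ← div_eq_mul_inv, le_div_iff₀ (by positivity), mul_comm]
  exact hle

/-- Cauchy-Schwarz; it turns the cellwise standard deviations into the number of cells times the
mass of the ring. -/
lemma sum_sqrt_le_sqrt_card_mul {ι : Type*} (S : Finset ι) {f : ι → ℝ} (hf : ∀ i, 0 ≤ f i) :
    ∑ i ∈ S, √(f i) ≤ √(S.card * ∑ i ∈ S, f i) := by
  refine Real.le_sqrt_of_sq_le (sq_sum_le_card_mul_sum_sq.trans_eq ?_)
  congr 1
  exact Finset.sum_congr rfl fun i _ => Real.sq_sqrt (hf i)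

namespace MarkovFamily

variable {d : ℕ} {Ω : Type*} [MeasurableSpace Ω]

/-- The expected total discrepancy over the level-`k` cells of the `n`-th ring. -/
lemma exists_sum_lintegral_discrepancy_le (P : MarkovFamily (EuclideanSpace ℝ (Fin d)) Ω)
    {μ : Measure (EuclideanSpace ℝ (Fin d))} [IsProbabilityMeasure μ]
    (hinv : P.IsInvariant μ) (hcoer : P.IsCoercive μ) {q : ℝ} (hq : 0 < q)
    (hmom : ∫⁻ x, ‖x‖ₑ ^ q ∂μ < ∞) :
    ∃ C : ℝ, 0 < C ∧ ∀ T : ℝ, 0 < T → ∀ k n : ℕ,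
      ∑ F ∈ dyadicLabels d k, ∫⁻ ω,
          ((P.empirical T ω (dyadicCell k ⁻¹' {(n, F)}) - μ (dyadicCell k ⁻¹' {(n, F)})) +
          (μ (dyadicCell k ⁻¹' {(n, F)}) - P.empirical T ω (dyadicCell k ⁻¹' {(n, F)})))
          ∂(P.lawFrom μ) ≤
        ENNReal.ofReal (C * (((2 : ℝ) ^ (-q)) ^ n *
          min 1 (((2 : ℝ) ^ ((d : ℝ) / 2)) ^ k * (((2 : ℝ) ^ (-q)) ^ n * T) ^ (-(1 / 2) : ℝ)))) := by
  obtain ⟨lam, hlam, hc⟩ := hcoer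
  obtain ⟨M, hM, hMn⟩ := exists_measureReal_dyadicRing_le hq hmom
  set C₁ : ℝ := √(3 ^ d * (4 / lam) * M) with hC₁
  refine ⟨2 * M + C₁, by positivity, fun T hT k n => ?_⟩
  set ε : ℝ := ((2 : ℝ) ^ (-q)) ^ n with hε
  have hε0 : 0 < ε := by positivity
  have hAm : ∀ F, MeasurableSet (dyadicCell k ⁻¹' {(n, F)} : Set (EuclideanSpace ℝ (Fin d))) :=
    fun F => measurable_dyadicCell k (measurableSet_singleton _)
  set s : ℝ := ((2 : ℝ) ^ ((d : ℝ) / 2)) ^ k with hs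
  set z : ℝ := s * (ε * T) ^ (-(1 / 2) : ℝ) with hz
  have hz0 : 0 < z := by positivity
  have hsum : ∑ F ∈ dyadicLabels d k, μ (dyadicCell k ⁻¹' {(n, F)}) ≤ ENNReal.ofReal (M * ε) := by
    rw [sum_measure_dyadicCell, ← ofReal_measureReal]
    exact ENNReal.ofReal_le_ofReal (hMn n)
  have hsumR : ∑ F ∈ dyadicLabels d k, μ.real (dyadicCell k ⁻¹' {(n, F)}) ≤ M * ε := by
    have := ENNReal.toReal_mono ENNReal.ofReal_ne_top hsum
    rwa [ENNReal.toReal_sum fun F _ => measure_ne_top _ _,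
      ENNReal.toReal_ofReal (by positivity)] at this
  -- If `z ≥ 1` the variance bound is worse than the trivial one: the discrepancy of a cell has mean
  -- at most `2 μ(cell)`. Otherwise the variance bound is summed over the cells.
  rcases le_total 1 z with h1 | h1
  · rw [min_eq_left h1, mul_one]
    calc _ ≤ ∑ F ∈ dyadicLabels d k, (μ (dyadicCell k ⁻¹' {(n, F)}) +
            μ (dyadicCell k ⁻¹' {(n, F)})) := by
          refine Finset.sum_le_sum fun F _ => ?_
          have : IsProbabilityMeasure (P.lawFrom μ) := P.isProbabilityMeasure_lawFrom μ
          calc _ ≤ ∫⁻ ω, (P.empirical T ω (dyadicCell k ⁻¹' {(n, F)}) +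
                μ (dyadicCell k ⁻¹' {(n, F)})) ∂(P.lawFrom μ) :=
                lintegral_mono fun ω => add_le_add tsub_le_self tsub_le_self
            _ = _ := by
                rw [lintegral_add_right _ measurable_const, P.lintegral_empirical hinv hT (hAm F),
                  lintegral_const, measure_univ, mul_one]
      _ ≤ ENNReal.ofReal (M * ε) + ENNReal.ofReal (M * ε) := by
          rw [Finset.sum_add_distrib]; exact add_le_add hsum hsum
      _ ≤ _ := by
          rw [← ENNReal.ofReal_add (by positivity) (by positivity)]
          refine ENNReal.ofReal_le_ofReal ?_
          have : 0 ≤ C₁ * ε := by positivity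
          linarith
  · rw [min_eq_right h1]
    calc _ ≤ ∑ F ∈ dyadicLabels d k,
            ENNReal.ofReal √(4 / lam * μ.real (dyadicCell k ⁻¹' {(n, F)}) / T) :=
          Finset.sum_le_sum fun F _ => P.lintegral_empirical_sub_le hinv hlam hc hT (hAm F)
      _ = ENNReal.ofReal (∑ F ∈ dyadicLabels d k,
            √(4 / lam * μ.real (dyadicCell k ⁻¹' {(n, F)}) / T)) :=
          (ENNReal.ofReal_sum_of_nonneg fun F _ => Real.sqrt_nonneg _).symm
      _ ≤ ENNReal.ofReal (C₁ * (ε * z)) := by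
          refine ENNReal.ofReal_le_ofReal ((sum_sqrt_le_sqrt_card_mul _ fun F => by positivity).trans ?_)
          rw [← Finset.sum_div, ← Finset.mul_sum]
          calc _ ≤ √((3 ^ d * (2 ^ d) ^ k) * (4 / lam * (M * ε) / T)) := by
                refine Real.sqrt_le_sqrt ?_
                gcongr
                exact card_dyadicLabels_le d k
            _ = √((3 ^ d * (4 / lam) * M) * (s ^ 2 * (ε / T))) := by
                congr 1
                have : s ^ 2 = ((2 : ℝ) ^ d) ^ k := by
                  have e : ((2 : ℝ) ^ ((d : ℝ) / 2)) ^ 2 = 2 ^ d := by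
                    rw [← Real.rpow_natCast, ← Real.rpow_mul two_pos.le, Nat.cast_ofNat,
                      div_mul_cancel₀ _ two_ne_zero, Real.rpow_natCast]
                  rw [hs, ← pow_mul, mul_comm k, pow_mul, e]
                rw [this]; ring
            _ = C₁ * (s * √(ε / T)) := by
                rw [Real.sqrt_mul (x := 3 ^ d * (4 / lam) * M) (by positivity),
                  Real.sqrt_mul (x := s ^ 2) (by positivity), Real.sqrt_sq (by positivity)]
            _ = C₁ * (ε * z) := by
                have : √(ε / T) = ε * (ε * T) ^ (-(1 / 2) : ℝ) := by
                  rw [Real.rpow_neg (by positivity), ← Real.sqrt_eq_rpow]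
                  rw [Real.sqrt_mul hε0.le, Real.sqrt_div hε0.le]
                  have h := Real.mul_self_sqrt hε0.le
                  have h' : 0 < √ε := Real.sqrt_pos.2 hε0
                  have h'' : 0 < √T := Real.sqrt_pos.2 hT
                  field_simp
                  nlinarith
                rw [this, hz]; ring
      _ ≤ _ := by
          refine ENNReal.ofReal_le_ofReal (mul_le_mul_of_nonneg_right ?_ (by positivity))
          linarith

/-- The rate of convergence of the empirical measure in expected transport cost. -/
lemma exists_lintegral_transportCost_le (hd : 0 < d)
    (P : MarkovFamily (EuclideanSpace ℝ (Fin d)) Ω)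
    {μ : Measure (EuclideanSpace ℝ (Fin d))} [IsProbabilityMeasure μ]
    (hinv : P.IsInvariant μ) (hcoer : P.IsCoercive μ) {p q : ℝ} (hp : 0 < p) (hpq : p < q)
    (hmom : ∫⁻ x, ‖x‖ₑ ^ q ∂μ < ∞) :
    ∃ C : ℝ, 0 < C ∧ ∀ T : ℝ, 2 ≤ T →
      ∫⁻ ω, transportCost p (P.empirical T ω) μ ∂(P.lawFrom μ) ≤
        ENNReal.ofReal
          (C * T ^ (-(1 - max (gammaTwo p d) (p / q)))
            * (if gammaTwo p d * q = p then Real.log T else 1)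
            * (if p = (d : ℝ) / 2 then Real.log T else 1)) := by
  have hq : 0 < q := hp.trans hpq
  obtain ⟨C₁, hC₁, h₁⟩ := P.exists_sum_lintegral_discrepancy_le hinv hcoer hq hmom
  obtain ⟨C₂, hC₂, h₂⟩ := exists_sum_scales_le hp hd
  obtain ⟨C₃, hC₃, h₃⟩ := exists_sum_rings_le hp hpq (gammaTwo_lt_one hp hd)
  obtain ⟨M, hM, hMn⟩ := exists_measureReal_dyadicRing_le hq hmom
  have : IsProbabilityMeasure (P.lawFrom μ) := P.isProbabilityMeasure_lawFrom μ
  set K : ℝ := (2 * (d + 1)) ^ p with hK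
  have hK0 : 0 < K := by positivity
  set b : ℝ := (2 : ℝ) ^ (-p) with hb
  have hb0 : 0 < b := by positivity
  have hb1 : b < 1 := Real.rpow_lt_one_of_one_lt_of_neg (by norm_num) (by linarith)
  set B : ℝ := (2 : ℝ) ^ p with hB
  set ε : ℝ := (2 : ℝ) ^ (-q) with hε
  -- The strict inequality `p < q` makes the `p`-cost of the finest scale summable over the rings.
  have hBε : B * ε < 1 := by
    rw [hB, hε, ← Real.rpow_add two_pos]
    exact Real.rpow_lt_one_of_one_lt_of_neg (by norm_num) (by linarith)
  refine ⟨K * C₁ * C₂ * C₃, by positivity, fun T hT => ?_⟩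
  have hT0 : 0 < T := by linarith
  set Λ : ℝ := if p = (d : ℝ) / 2 then Real.log T else 1 with hΛ
  set Λ' : ℝ := if gammaTwo p d * q = p then Real.log T else 1
  have hlog : 0 < Real.log T := Real.log_pos (by linarith)
  have hΛ0 : 0 < Λ := by rw [hΛ]; split_ifs <;> [exact hlog; exact one_pos]
  have hemp := fun ω => P.isProbabilityMeasure_empirical hT0 ω
  have hεn : ∀ n : ℕ, 0 < ε ^ n ∧ ε ^ n ≤ 1 := fun n =>
    ⟨by positivity, pow_le_one₀ (by positivity)
      (Real.rpow_le_one_of_one_le_of_nonpos (by norm_num) (by linarith))⟩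
  let G : ℕ → ℕ → (Fin d → ℤ) → Ω → ℝ≥0∞ := fun k n F ω =>
    (P.empirical T ω (dyadicCell k ⁻¹' {(n, F)}) - μ (dyadicCell k ⁻¹' {(n, F)})) +
      (μ (dyadicCell k ⁻¹' {(n, F)}) - P.empirical T ω (dyadicCell k ⁻¹' {(n, F)}))
  have hG : ∀ k n F, Measurable (G k n F) := fun k n F => by
    have := P.measurable_empirical_apply T (measurable_dyadicCell k (measurableSet_singleton (n, F)))
    exact (this.sub measurable_const).add (measurable_const.sub this)
  -- the contribution of the finest scale
  have hfine : ∀ L : ℕ, ∑' n, ENNReal.ofReal (scaleWeight d p (L + 1) n) *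
      μ (dyadicRing ⁻¹' {n}) ≤ ENNReal.ofReal (K * M * (1 - B * ε)⁻¹ * b ^ (L + 1)) := by
    intro L
    calc _ ≤ ∑' n, ENNReal.ofReal (K * M * b ^ (L + 1) * (B * ε) ^ n) := by
          refine ENNReal.tsum_le_tsum fun n => ?_
          rw [← ofReal_measureReal (μ := μ), ← ENNReal.ofReal_mul (scaleWeight_nonneg _ _ _ _)]
          refine ENNReal.ofReal_le_ofReal
            ((mul_le_mul_of_nonneg_left (hMn n) (scaleWeight_nonneg _ _ _ _)).trans_eq ?_)
          rw [scaleWeight, mul_pow]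
          ring
      _ ≤ _ := by
          refine tsum_ofReal_le (fun n => by positivity) fun N => ?_
          rw [← Finset.mul_sum]
          calc _ ≤ K * M * b ^ (L + 1) * (1 - B * ε)⁻¹ := by
                gcongr
                exact sum_range_pow_le (by positivity) hBε N
            _ = _ := by ring
  -- the contribution of the other scales
  have hcoarse : ∀ L : ℕ, ∑ k ∈ Finset.range (L + 1), ∑' n, ENNReal.ofReal (scaleWeight d p k n) *
      ∑ F ∈ dyadicLabels d k, ∫⁻ ω, G k n F ω ∂(P.lawFrom μ) ≤
      ENNReal.ofReal (K * C₁ * C₂ * C₃ * T ^ (-(1 - max (gammaTwo p d) (p / q))) * Λ' * Λ) := by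
    intro L
    set y : ℕ → ℕ → ℝ := fun k n =>
      min 1 (((2 : ℝ) ^ ((d : ℝ) / 2)) ^ k * (ε ^ n * T) ^ (-(1 / 2) : ℝ)) with hy
    have hy0 : ∀ k n, 0 ≤ y k n := fun k n => le_min zero_le_one (by positivity)
    calc _ ≤ ∑ k ∈ Finset.range (L + 1), ∑' n,
            ENNReal.ofReal (scaleWeight d p k n * (C₁ * (ε ^ n * y k n))) := by
          refine Finset.sum_le_sum fun k _ => ENNReal.tsum_le_tsum fun n => ?_
          rw [ENNReal.ofReal_mul (scaleWeight_nonneg _ _ _ _)]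
          exact mul_le_mul_right (h₁ T hT0 k n) _
      _ = ∑' n, ENNReal.ofReal
            (∑ k ∈ Finset.range (L + 1), scaleWeight d p k n * (C₁ * (ε ^ n * y k n))) := by
          rw [← Summable.tsum_finsetSum fun k _ => ENNReal.summable]
          refine tsum_congr fun n => (ENNReal.ofReal_sum_of_nonneg fun k _ => ?_).symm
          exact mul_nonneg (scaleWeight_nonneg _ _ _ _)
            (mul_nonneg hC₁.le (mul_nonneg (hεn n).1.le (hy0 k n)))
      _ ≤ ∑' n, ENNReal.ofReal (K * C₁ * C₂ * Λ *
            (B ^ n * (ε ^ n * min 1 ((ε ^ n * T) ^ (-(1 - gammaTwo p d)))))) := by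
          refine ENNReal.tsum_le_tsum fun n => ENNReal.ofReal_le_ofReal ?_
          have h := h₂ T (ε ^ n * T) hT (mul_pos (hεn n).1 hT0)
            (mul_le_of_le_one_left hT0.le (hεn n).2) (L + 1)
          calc _ = K * C₁ * (B ^ n * ε ^ n) * ∑ k ∈ Finset.range (L + 1), b ^ k * y k n := by
                rw [Finset.mul_sum]
                refine Finset.sum_congr rfl fun k _ => ?_
                rw [scaleWeight]
                ring
            _ ≤ K * C₁ * (B ^ n * ε ^ n) *
                (C₂ * Λ * min 1 ((ε ^ n * T) ^ (-(1 - gammaTwo p d)))) :=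
                mul_le_mul_of_nonneg_left h (by positivity)
            _ = _ := by ring
      _ ≤ _ := by
          refine tsum_ofReal_le (fun n => ?_) fun N => ?_
          · have : 0 ≤ min 1 ((ε ^ n * T) ^ (-(1 - gammaTwo p d))) :=
              le_min zero_le_one (by positivity)
            positivity
          · rw [← Finset.mul_sum]
            calc _ ≤ K * C₁ * C₂ * Λ * (C₃ * T ^ (-(1 - max (gammaTwo p d) (p / q))) * Λ') :=
                  mul_le_mul_of_nonneg_left (h₃ T hT N) (by positivity)
              _ = _ := by ring
  have hL : ∀ L : ℕ, ∫⁻ ω, transportCost p (P.empirical T ω) μ ∂(P.lawFrom μ) ≤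
      ENNReal.ofReal (K * M * (1 - B * ε)⁻¹ * b ^ (L + 1)) +
      ENNReal.ofReal (K * C₁ * C₂ * C₃ * T ^ (-(1 - max (gammaTwo p d) (p / q))) * Λ' * Λ) := by
    intro L
    -- Monotonicity of the lower integral requires no measurability of the transport cost in `ω`;
    -- only the dominating sum has to be measurable.
    calc _ ≤ ∫⁻ ω, (∑' n, ENNReal.ofReal (scaleWeight d p (L + 1) n) * μ (dyadicRing ⁻¹' {n}) +
          ∑ k ∈ Finset.range (L + 1), ∑' n, ENNReal.ofReal (scaleWeight d p k n) *
            ∑ F ∈ dyadicLabels d k, G k n F ω) ∂(P.lawFrom μ) :=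
          lintegral_mono fun ω => transportCost_le hp (P.empirical T ω) μ L
      _ = ∑' n, ENNReal.ofReal (scaleWeight d p (L + 1) n) * μ (dyadicRing ⁻¹' {n}) +
          ∑ k ∈ Finset.range (L + 1), ∑' n, ENNReal.ofReal (scaleWeight d p k n) *
            ∑ F ∈ dyadicLabels d k, ∫⁻ ω, G k n F ω ∂(P.lawFrom μ) := by
          have hm : ∀ k n, Measurable fun ω => ∑ F ∈ dyadicLabels d k, G k n F ω := fun k n =>
            Finset.measurable_sum _ fun F _ => hG k n F
          rw [lintegral_add_left measurable_const, lintegral_const, measure_univ, mul_one,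
            lintegral_finsetSum _ fun k _ => Measurable.tsum fun n => (hm k n).const_mul _]
          congr 1
          refine Finset.sum_congr rfl fun k _ => ?_
          rw [lintegral_tsum fun n => ((hm k n).const_mul _).aemeasurable]
          refine tsum_congr fun n => ?_
          rw [lintegral_const_mul _ (hm k n), lintegral_finsetSum _ fun F _ => hG k n F]
      _ ≤ _ := add_le_add (hfine L) (hcoarse L)
  -- The bound on the other scales is uniform in `L`, so the finest scale is removed by letting `L →
  -- ∞`.
  have hlim : Tendsto (fun L : ℕ => ENNReal.ofReal (K * M * (1 - B * ε)⁻¹ * b ^ (L + 1)) +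
      ENNReal.ofReal (K * C₁ * C₂ * C₃ * T ^ (-(1 - max (gammaTwo p d) (p / q))) * Λ' * Λ)) atTop
      (𝓝 (0 + ENNReal.ofReal
        (K * C₁ * C₂ * C₃ * T ^ (-(1 - max (gammaTwo p d) (p / q))) * Λ' * Λ))) := by
    refine Tendsto.add ?_ tendsto_const_nhds
    rw [← ENNReal.ofReal_zero]
    refine ENNReal.tendsto_ofReal ?_
    have := ((tendsto_add_atTop_iff_nat 1).2
      (tendsto_pow_atTop_nhds_zero_of_lt_one hb0.le hb1)).const_mul (K * M * (1 - B * ε)⁻¹)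
    rwa [mul_zero] at this
  rw [zero_add] at hlim
  exact ge_of_tendsto' hlim hL

end MarkovFamily

theorem theorem1p3 {d : ℕ} (hd : 0 < d) {Ω : Type*} [MeasurableSpace Ω]
    (P : MarkovFamily (EuclideanSpace ℝ (Fin d)) Ω)
    (μ : Measure (EuclideanSpace ℝ (Fin d))) [IsProbabilityMeasure μ]
    (hinv : P.IsInvariant μ) (hcoer : P.IsCoercive μ)
    (p q : ℝ) (hp : 0 < p) (hpq : p < q) (hmom : ∫⁻ x, ‖x‖ₑ ^ q ∂μ < ∞) :
    ∃ C : ℝ, 0 < C ∧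
      (∀ T : ℝ, 2 ≤ T →
        ∫⁻ ω, transportCost p (P.empirical T ω) μ ∂(P.lawFrom μ) ≤
          ENNReal.ofReal
            (C * T ^ (-(1 - max (gammaTwo p d) (p / q)))
              * (if gammaTwo p d * q = p then Real.log T else 1)
              * (if p = (d : ℝ) / 2 then Real.log T else 1))) ∧
      (2 * p < q → ∀ T : ℝ, 2 ≤ T →
        ((d : ℝ) / 2 < p →
          ∫⁻ ω, transportCost p (P.empirical T ω) μ ∂(P.lawFrom μ) ≤
            ENNReal.ofReal (C * T ^ (-(1 / 2) : ℝ))) ∧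
        (p = (d : ℝ) / 2 →
          ∫⁻ ω, transportCost p (P.empirical T ω) μ ∂(P.lawFrom μ) ≤
            ENNReal.ofReal (C * T ^ (-(1 / 2) : ℝ) * Real.log T)) ∧
        (p < (d : ℝ) / 2 →
          ∫⁻ ω, transportCost p (P.empirical T ω) μ ∂(P.lawFrom μ) ≤
            ENNReal.ofReal (C * T ^ (-(p / d))))) := by
  obtain ⟨C, hC, h⟩ := P.exists_lintegral_transportCost_le hd hinv hcoer hp hpq hmom
  refine ⟨C, hC, h, fun hq2 T hT => ?_⟩
  have hd' : (0 : ℝ) < d := by exact_mod_cast hd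
  have hq : 0 < q := hp.trans hpq
  have hγ : 1 / 2 ≤ gammaTwo p d := le_max_left _ _
  -- From `q > 2p` and `γ₂ ≥ 1/2` follows `γ₂ q > p`: the ring logarithm is absent, and `γ₂` wins
  -- the maximum.
  have hne : gammaTwo p d * q ≠ p := by
    have : p < gammaTwo p d * q := by nlinarith
    exact this.ne'
  have hmax : max (gammaTwo p d) (p / q) = gammaTwo p d :=
    max_eq_left (le_trans (by rw [div_le_iff₀ hq]; linarith) hγ)
  have hT' := h T hT
  rw [if_neg hne, hmax, mul_one] at hT'
  refine ⟨fun hpd => ?_, fun hpd => ?_, fun hpd => ?_⟩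
  · have hg : gammaTwo p d = 1 / 2 := by
      refine max_eq_left ?_
      rw [sub_le_comm, le_div_iff₀ hd']
      linarith
    rw [if_neg hpd.ne', mul_one, hg] at hT'
    convert hT' using 4
    norm_num
  · have hg : gammaTwo p d = 1 / 2 := by
      refine max_eq_left ?_
      rw [sub_le_comm, le_div_iff₀ hd']
      linarith
    rw [if_pos hpd, hg] at hT'
    convert hT' using 5
    norm_num
  · have hg : gammaTwo p d = 1 - p / d := by
      refine max_eq_right ?_
      rw [le_sub_comm, div_le_iff₀ hd']
      linarith
    rw [if_neg hpd.ne, mul_one, hg, sub_sub_cancel] at hT'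
    exact hT'
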